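/- Let $\mathcal X$ be a complex Hilbert space, let $B$ be a selfadjoint operator in $\mathcal X$ with dense domain $D(B)$, and let $J$ be a bounded linear operator on $\mathcal X$ with $J^*=-J$ and $J^2=-1$. Assume that the spectrum satisfies $\sigma(B)\subset[\delta,\infty)$ for some $\delta>0$. Then $B$ has a nonnegative selfadjoint square root. Let $\Lambda=B^{1/2}$ be the nonnegative selfadjoint operator with $\Lambda^2=B$, let $\mathcal V=D(\Lambda)$ with the norm $\|x\|_{\mathcal V}=\|\Lambda x\|_{\mathcal X}$, and let $H=\Lambda\, iJ\Lambda$ with domain $D(H)=\{x\in\mathcal V:\ J\Lambda x\in\mathcal V\}$. Then $\Lambda:\mathcal V\to\mathcal X$ is bijective, and $H$ is selfadjoint and has a spectral resolution $E$. By this we mean an increasing, strongly right-continuous family $(E(\omega))_{\omega\in\mathbb R}$ of orthogonal projections in $\mathcal X$, tending strongly to $0$ as $\omega\to-\infty$ and to the identity as $\omega\to\infty$, such that $H=\int\omega\,dE(\omega)$, i.e. $Z\in D(H)$ if and only if $\int\omega\,dE(\omega)Z$ converges in $\mathcal X$, and then $HZ=\int\omega\,dE(\omega)Z$. The integrals over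 $\mathbb R$ are limits in the norm of $\mathcal X$, as $a\to-\infty$ and $b\to\infty$, of Riemann–Stieltjes integrals over $[a,b]$. A solution of $\dot X(t)=JBX(t)$, $t\in\mathbb R$, is a function $X\in C(\mathbb R,\mathcal V)$ such that, for every $t\in\mathbb R$, $\int_0^tX(s)\,ds\in D(B)$ and $$X(t)-X(0)=JB\int_0^tX(s)\,ds .$$ For every initial value $X(0)\in\mathcal V$ there is a solution. For every spectral resolution $E$ of $H$, every solution $X$ and every $t\in\mathbb R$, the integral below converges in $\mathcal X$, and $$X(t)=\Lambda^{-1}\int e^{-i\omega t}\,dE(\omega)\,\Lambda X(0).$$ -/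

import Mathlib

open Filter Topology Set

noncomputable section

namespace ComplexHamilton

/-- The composition `g ∘ f` of two partially defined operators on its natural (maximal) domain
`{x ∈ D(f) | f x ∈ D(g)}`. -/
def comp {E : Type*} [AddCommGroup E] [Module ℂ E] (g f : E →ₗ.[ℂ] E) : E →ₗ.[ℂ] E where
  domain :=
    { carrier := {x | ∃ h : x ∈ f.domain, f ⟨x, h⟩ ∈ g.domain}
      zero_mem' := ⟨f.domain.zero_mem, by
        have h0 : f ⟨0, f.domain.zero_mem⟩ = 0 := f.map_zero
        rw [h0]; exact g.domain.zero_mem⟩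
      add_mem' := by
        rintro x y ⟨hx, hx'⟩ ⟨hy, hy'⟩
        refine ⟨f.domain.add_mem hx hy, ?_⟩
        have h0 : f ⟨x + y, f.domain.add_mem hx hy⟩ = f ⟨x, hx⟩ + f ⟨y, hy⟩ :=
          f.map_add ⟨x, hx⟩ ⟨y, hy⟩
        rw [h0]; exact g.domain.add_mem hx' hy'
      smul_mem' := by
        rintro c x ⟨hx, hx'⟩
        refine ⟨f.domain.smul_mem c hx, ?_⟩
        have h0 : f ⟨c • x, f.domain.smul_mem c hx⟩ = c • f ⟨x, hx⟩ := f.map_smul c ⟨x, hx⟩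
        rw [h0]; exact g.domain.smul_mem c hx' }
  toFun :=
    { toFun := fun x => g ⟨f ⟨x.1, x.2.1⟩, x.2.2⟩
      map_add' := by
        rintro ⟨x, hx, hx'⟩ ⟨y, hy, hy'⟩
        rw [← g.map_add]
        congr 1
        exact Subtype.ext (f.map_add ⟨x, hx⟩ ⟨y, hy⟩)
      map_smul' := by
        rintro c ⟨x, hx, hx'⟩
        rw [RingHom.id_apply, ← g.map_smul]
        congr 1
        exact Subtype.ext (f.map_smul c ⟨x, hx⟩) }

variable {𝒳 : Type*} [NormedAddCommGroup 𝒳] [InnerProductSpace ℂ 𝒳]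

/-- The resolvent set of a (possibly unbounded) operator `T`: the numbers `z` for which
`T - z : D(T) → 𝒳` is a bijection with bounded inverse `R`. -/
def resolventSet (T : 𝒳 →ₗ.[ℂ] 𝒳) : Set ℂ :=
  {z | ∃ R : 𝒳 →L[ℂ] 𝒳,
      (∀ y : 𝒳, ∃ h : R y ∈ T.domain, T ⟨R y, h⟩ - z • R y = y) ∧
      (∀ x : T.domain, R (T x - z • (x : 𝒳)) = x)}

/-- The spectrum of a (possibly unbounded) operator. -/
def spectrum (T : 𝒳 →ₗ.[ℂ] 𝒳) : Set ℂ := (resolventSet T)ᶜ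

/-- `Λ = B^{1/2}`: `Λ` is selfadjoint and nonnegative and `Λ² = B`, equality of domains included. -/
structure IsPositiveSqrt [CompleteSpace 𝒳] (Λ B : 𝒳 →ₗ.[ℂ] 𝒳) : Prop where
  selfAdjoint : IsSelfAdjoint Λ
  nonneg : ∀ x : Λ.domain, 0 ≤ (inner ℂ (Λ x) (x : 𝒳)).re
  sq_eq : comp Λ Λ = B

/-- The Hamilton generator `A = J B`, with domain `D(B)`. -/
def generator (J : 𝒳 →L[ℂ] 𝒳) (B : 𝒳 →ₗ.[ℂ] 𝒳) : 𝒳 →ₗ.[ℂ] 𝒳 :=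
  (J : 𝒳 →ₗ[ℂ] 𝒳).compPMap B

/-- The operator `H = Λ i J Λ`, with domain `{x ∈ D(Λ) | i J Λ x ∈ D(Λ)}`. -/
def schrodinger (J : 𝒳 →L[ℂ] 𝒳) (Λ : 𝒳 →ₗ.[ℂ] 𝒳) : 𝒳 →ₗ.[ℂ] 𝒳 :=
  comp Λ (((Complex.I • J : 𝒳 →L[ℂ] 𝒳) : 𝒳 →ₗ[ℂ] 𝒳).compPMap Λ)

/-- Mild solutions of class `C(ℝ, 𝒱)` of `Ẋ = J B X`. Here `𝒱 = D(Λ)` carries the norm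
`‖x‖_𝒱 = ‖Λ x‖`, so that continuity into `𝒱` is continuity of `t ↦ Λ (X t)`. The equation is
`X(t) - X(0) = A ∫₀ᵗ X(s) ds` for all real `t`, where the integral has to lie in `D(A)`. -/
structure IsMildSolution (J : 𝒳 →L[ℂ] 𝒳) (B Λ : 𝒳 →ₗ.[ℂ] 𝒳) (X : ℝ → Λ.domain) : Prop where
  continuous : Continuous fun t => Λ (X t)
  equation : ∀ t : ℝ, ∃ h : (∫ s in (0 : ℝ)..t, (X s : 𝒳)) ∈ (generator J B).domain,
    (X t : 𝒳) - X 0 = generator J B ⟨∫ s in (0 : ℝ)..t, (X s : 𝒳), h⟩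

/-- `I` is the Riemann–Stieltjes integral `∫_a^b f(ω) dF(ω)`: the limit in norm of the sums over
tagged partitions `a = p 0 ≤ p 1 ≤ … ≤ p n = b`, `ξ i ∈ [p i, p (i+1)]`, as the mesh tends to zero. -/
def HasRSIntegral (f : ℝ → ℂ) (F : ℝ → 𝒳) (a b : ℝ) (I : 𝒳) : Prop :=
  ∀ ε > (0 : ℝ), ∃ η > (0 : ℝ), ∀ (n : ℕ) (p ξ : ℕ → ℝ),
    p 0 = a → p n = b →
    (∀ i < n, ξ i ∈ Icc (p i) (p (i + 1)) ∧ p (i + 1) - p i < η) →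
    ‖(∑ i ∈ Finset.range n, f (ξ i) • (F (p (i + 1)) - F (p i))) - I‖ < ε

/-- `I` is the improper Riemann–Stieltjes integral `∫_{-∞}^{∞} f(ω) dF(ω)`: the integrals over all
compact intervals `[a, b]` exist and converge to `I` in norm as `a → -∞` and `b → ∞`. -/
def HasImproperRSIntegral (f : ℝ → ℂ) (F : ℝ → 𝒳) (I : 𝒳) : Prop :=
  ∃ K : ℝ → ℝ → 𝒳, (∀ a b : ℝ, a ≤ b → HasRSIntegral f F a b (K a b)) ∧
    Tendsto (fun q : ℝ × ℝ => K q.1 q.2) (atBot ×ˢ atTop) (𝓝 I)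

/-- A spectral family (resolution of the identity): an increasing, strongly right-continuous family
of orthogonal projections that tends strongly to `0` at `-∞` and to the identity at `∞`. -/
structure IsSpectralFamily [CompleteSpace 𝒳] (E : ℝ → 𝒳 →L[ℂ] 𝒳) : Prop where
  projection : ∀ ω, IsStarProjection (E ω)
  monotone : ∀ ω ω', ω ≤ ω' → E ω ∘L E ω' = E ω
  rightContinuous : ∀ (ω : ℝ) (Z : 𝒳), Tendsto (fun s => E s Z) (𝓝[>] ω) (𝓝 (E ω Z))
  atBot : ∀ Z : 𝒳, Tendsto (fun ω => E ω Z) atBot (𝓝 0)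
  atTop : ∀ Z : 𝒳, Tendsto (fun ω => E ω Z) atTop (𝓝 Z)

/-- `E` is the spectral resolution of the operator `H`, that is `H = ∫ ω dE(ω)`: a vector `Z` lies in
`D(H)` if and only if the integral `∫ ω dE(ω) Z` converges in norm, and then `H Z` is its value. -/
structure IsSpectralResolution [CompleteSpace 𝒳] (E : ℝ → 𝒳 →L[ℂ] 𝒳) (H : 𝒳 →ₗ.[ℂ] 𝒳) :
    Prop where
  family : IsSpectralFamily E
  integral : ∀ Z W : 𝒳, (∃ h : Z ∈ H.domain, H ⟨Z, h⟩ = W) ↔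
    HasImproperRSIntegral (fun ω => (ω : ℂ)) (fun ω => E ω Z) W

end ComplexHamilton

end

/-! Every unbounded operator here has a bounded everywhere defined inverse, and the proof works with
these inverses. Since `0` is in the resolvent set, `B` has an inverse `R ≥ 0`; then `Λ` is the
inverse of `S` with `S² = R`, and `H` is the inverse of `K = S (iJ) S`, which is bounded,
selfadjoint and injective. Selfadjointness passes from `K` to `H` because `H` and its adjoint have
the same inverse.

The spectral projections of `H` come from the continuous functional calculus of `K`: for `κ ≠ 0`,
`κ⁻¹ ≤ ω` means `κ - ω κ² ≤ 0`, so `E ω` projects onto the kernel of the positive part of `K - ω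
K²`.

Everything else rests on one property, `Localizes`: on the range of `E q - E p` the operator `H` is
within `q - p` of each `c ∈ [p, q]`. It holds for the constructed family (`localizes_spectralProj`)
and for every spectral resolution (`localizes_of_hasImproperRSIntegral`), so the solution formula
holds for an arbitrary `E`. With Pythagoras over the cells of a partition it makes the
Riemann–Stieltjes sums converge.

For the dynamics, `Y = Λ X` turns the mild equation into `∫ Y = i K (Y t - Y 0)`
(`isMildSolution_iff`). Cut to a cell, this is a Schrödinger equation with bounded generator; its
flow preserves norms and differs from `e^{-ict}` by at most `(q - p)|t|` relative to the initial
norm. Summing over cells gives the formula, and letting the cut-offs `[-n, n]` grow gives existence.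
-/

noncomputable section

namespace ComplexHamilton

/-! ### Unbounded operators described by their bounded inverses; square roots. -/

section BoundedInverse

variable {𝒳 : Type*} [NormedAddCommGroup 𝒳] [InnerProductSpace ℂ 𝒳]

/-- The bounded operator `R` is the everywhere defined inverse of `T`. -/
def HasInverse (T : 𝒳 →ₗ.[ℂ] 𝒳) (R : 𝒳 →L[ℂ] 𝒳) : Prop :=
  ∀ Z W : 𝒳, (∃ h : Z ∈ T.domain, T ⟨Z, h⟩ = W) ↔ R W = Z

namespace HasInverse

variable {T T' : 𝒳 →ₗ.[ℂ] 𝒳} {R R' : 𝒳 →L[ℂ] 𝒳}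

lemma mem (h : HasInverse T R) (W : 𝒳) : R W ∈ T.domain :=
  ((h (R W) W).2 rfl).1

lemma apply_inverse (h : HasInverse T R) (W : 𝒳) : T ⟨R W, h.mem W⟩ = W :=
  ((h (R W) W).2 rfl).2

lemma inverse_apply (h : HasInverse T R) (x : T.domain) : R (T x) = x :=
  (h x (T x)).1 ⟨x.2, rfl⟩

lemma injective (h : HasInverse T R) : Function.Injective R := by
  intro W W' e
  obtain ⟨h1, h2⟩ := (h (R W) W).2 rfl
  obtain ⟨h3, h4⟩ := (h (R W) W').2 e.symm
  exact h2.symm.trans h4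

lemma bijective (h : HasInverse T R) : Function.Bijective (fun x : T.domain => T x) := by
  refine ⟨fun x y e => Subtype.ext ?_, fun W => ⟨⟨R W, h.mem W⟩, h.apply_inverse W⟩⟩
  rw [← h.inverse_apply x, ← h.inverse_apply y]
  exact congrArg R e

lemma mem_graph (h : HasInverse T R) (x : 𝒳 × 𝒳) : x ∈ T.graph ↔ R x.2 = x.1 := by
  rw [← h x.1 x.2, LinearPMap.mem_graph_iff]
  constructor
  · rintro ⟨y, h1, h2⟩
    obtain ⟨y, hy⟩ := y
    obtain ⟨x1, x2⟩ := x
    simp only at h1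
    subst h1
    exact ⟨hy, h2⟩
  · rintro ⟨h1, h2⟩
    exact ⟨⟨x.1, h1⟩, rfl, h2⟩

lemma ext (h : HasInverse T R) (h' : HasInverse T' R) : T = T' := by
  apply LinearPMap.eq_of_eq_graph
  ext x
  rw [h.mem_graph, h'.mem_graph]

lemma comp (h : HasInverse T R) (h' : HasInverse T' R') :
    HasInverse (ComplexHamilton.comp T T') (R' ∘L R) := by
  intro Z W
  constructor
  · rintro ⟨⟨h1, h2⟩, h3⟩
    have h4 : R W = T' ⟨Z, h1⟩ := (h _ _).1 ⟨h2, h3⟩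
    rw [ContinuousLinearMap.comp_apply, h4, h'.inverse_apply]
  · intro e
    obtain ⟨h1, h2⟩ := (h' Z (R W)).2 e
    obtain ⟨h3, h4⟩ := (h (T' ⟨Z, h1⟩) W).2 h2.symm
    exact ⟨⟨h1, h3⟩, h4⟩

lemma compPMap (h : HasInverse T R) {U U' : 𝒳 →L[ℂ] 𝒳} (hU : U ∘L U' = .id ℂ 𝒳)
    (hU' : U' ∘L U = .id ℂ 𝒳) :
    HasInverse ((U : 𝒳 →ₗ[ℂ] 𝒳).compPMap T) (R ∘L U') := by
  intro Z W
  have e1 : ∀ x, U (U' x) = x := fun x => DFunLike.congr_fun hU x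
  have e2 : ∀ x, U' (U x) = x := fun x => DFunLike.congr_fun hU' x
  constructor
  · rintro ⟨h1, h2⟩
    refine (h _ _).1 ⟨h1, ?_⟩
    rw [← h2]
    exact (e2 _).symm
  · intro e
    obtain ⟨h1, h2⟩ := (h Z (U' W)).2 e
    refine ⟨h1, ?_⟩
    change U (T ⟨Z, h1⟩) = W
    rw [h2, e1]

lemma exists_of_injective (hR : Function.Injective R) : ∃ T, HasInverse T R := by
  have hker : LinearMap.ker ((R : 𝒳 →ₗ[ℂ] 𝒳).toPMap ⊤).toFun = ⊥ := by
    rw [LinearMap.ker_eq_bot]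
    intro x y e
    exact Subtype.ext (hR e)
  refine ⟨((R : 𝒳 →ₗ[ℂ] 𝒳).toPMap ⊤).inverse, fun Z W => ?_⟩
  have hg : (Z, W) ∈ ((R : 𝒳 →ₗ[ℂ] 𝒳).toPMap ⊤).inverse.graph ↔ R W = Z := by
    rw [LinearPMap.inverse_graph hker]
    constructor
    · rintro ⟨⟨a, b⟩, h1, h2⟩
      rw [SetLike.mem_coe, LinearPMap.mem_graph_iff] at h1
      obtain ⟨y, h3, h4⟩ := h1
      simp only [LinearEquiv.coe_coe, LinearEquiv.prodComm_apply, Prod.swap_prod_mk,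
        Prod.mk.injEq] at h2 h3 h4
      rw [← h2.1, ← h2.2, ← h4, ← h3]
      rfl
    · intro e
      refine ⟨(W, Z), ?_, rfl⟩
      rw [SetLike.mem_coe, LinearPMap.mem_graph_iff]
      exact ⟨⟨W, trivial⟩, rfl, e⟩
  rw [← hg, LinearPMap.mem_graph_iff]
  constructor
  · rintro ⟨h1, h2⟩
    exact ⟨⟨Z, h1⟩, rfl, h2⟩
  · rintro ⟨⟨y, hy⟩, h1, h2⟩
    simp only at h1 h2
    subst h1
    exact ⟨hy, h2⟩

lemma exists_of_zero_mem_resolventSet (h0 : (0 : ℂ) ∈ resolventSet T) :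
    ∃ R, HasInverse T R := by
  obtain ⟨R, h1, h2⟩ := h0
  refine ⟨R, fun Z W => ⟨?_, ?_⟩⟩
  · rintro ⟨h3, rfl⟩
    simpa using h2 ⟨Z, h3⟩
  · rintro rfl
    obtain ⟨h3, h4⟩ := h1 W
    exact ⟨h3, by simpa using h4⟩

variable [CompleteSpace 𝒳]

lemma _root_.IsSelfAdjoint.denseRange_of_injective {R : 𝒳 →L[ℂ] 𝒳} (hR : IsSelfAdjoint R)
    (hinj : Function.Injective R) : DenseRange R := by
  have h1 : (R : 𝒳 →ₗ[ℂ] 𝒳).rangeᗮ = ⊥ := by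
    have := ContinuousLinearMap.orthogonal_range R
    rw [← ContinuousLinearMap.star_eq_adjoint, hR.star_eq] at this
    rw [this]
    exact LinearMap.ker_eq_bot.2 hinj
  have h2 := (Submodule.topologicalClosure_eq_top_iff (K := (R : 𝒳 →ₗ[ℂ] 𝒳).range)).2 h1
  have := Submodule.dense_iff_topologicalClosure_eq_top.2 h2
  exact this

lemma _root_.IsSelfAdjoint.inner_map_left {R : 𝒳 →L[ℂ] 𝒳} (hR : IsSelfAdjoint R) (x y : 𝒳) :
    inner ℂ (R x) y = inner ℂ x (R y) :=
  (ContinuousLinearMap.isSelfAdjoint_iff_isSymmetric.1 hR) x y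

/-- The adjoint of `T` also has inverse `R`, and an operator is determined by its inverse. -/
lemma isSelfAdjoint (h : HasInverse T R) (hR : IsSelfAdjoint R) : IsSelfAdjoint T := by
  have hd : Dense (T.domain : Set 𝒳) := by
    refine (hR.denseRange_of_injective h.injective).mono ?_
    rintro _ ⟨W, rfl⟩
    exact h.mem W
  have h' : HasInverse T.adjoint R := by
    intro Z W
    constructor
    · rintro ⟨h1, h2⟩
      refine ext_inner_right ℂ fun v => ?_
      have := LinearPMap.adjoint_isFormalAdjoint hd ⟨Z, h1⟩ ⟨R v, h.mem v⟩
      rw [h.apply_inverse, h2] at this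
      rw [hR.inner_map_left]
      exact this
    · intro e
      have key : ∀ x : T.domain, inner ℂ W (x : 𝒳) = inner ℂ Z (T x) := by
        intro x
        rw [← e, hR.inner_map_left, h.inverse_apply]
      have hm : Z ∈ T.adjoint.domain := LinearPMap.mem_adjoint_domain_of_exists Z ⟨W, key⟩
      exact ⟨hm, LinearPMap.adjoint_apply_eq hd ⟨Z, hm⟩ key⟩
  exact (LinearPMap.isSelfAdjoint_def).2 (h'.ext h)

lemma isSelfAdjoint_inverse (h : HasInverse T R) (hT : IsSelfAdjoint T) : IsSelfAdjoint R := by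
  rw [ContinuousLinearMap.isSelfAdjoint_iff_isSymmetric]
  intro x y
  have h0 : T.adjoint = T := LinearPMap.isSelfAdjoint_def.1 hT
  have hf : T.IsFormalAdjoint T := by
    have := LinearPMap.adjoint_isFormalAdjoint hT.dense_domain
    rwa [h0] at this
  have := hf ⟨R x, h.mem x⟩ ⟨R y, h.mem y⟩
  rw [h.apply_inverse, h.apply_inverse] at this
  exact this.symm

lemma nonneg_of_spectrum (h : HasInverse T R) (hR : IsSelfAdjoint R)
    (hT : ∀ r < (0 : ℝ), (r : ℂ) ∈ resolventSet T) : 0 ≤ R := by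
  rw [StarOrderedRing.nonneg_iff_spectrum_nonneg (R := ℝ) R hR]
  intro s hs
  by_contra! hneg
  refine hs ?_
  obtain ⟨G, h1, h2⟩ := hT s⁻¹ (inv_lt_zero.2 hneg)
  have hs0 : (s : ℂ) ≠ 0 := by exact_mod_cast hneg.ne
  have hval : ∀ V, (algebraMap ℝ (𝒳 →L[ℂ] 𝒳) s - R) V = (s : ℂ) • V - R V := fun V => by
    rw [sub_apply, Algebra.algebraMap_eq_smul_one, Complex.coe_smul]
    rfl
  -- From `s - T⁻¹ = s (T - s⁻¹) T⁻¹`, the inverse is `s⁻¹ T (T - s⁻¹)⁻¹ = s⁻¹ (1 + s⁻¹ G)`.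
  refine ⟨⟨algebraMap ℝ (𝒳 →L[ℂ] 𝒳) s - R, (s : ℂ)⁻¹ • (1 + (s : ℂ)⁻¹ • G), ?_, ?_⟩, rfl⟩
  · ext y
    obtain ⟨h3, h4⟩ := h1 y
    have h5 : R (y + (s : ℂ)⁻¹ • G y) = G y := by
      refine (h _ _).1 ⟨h3, ?_⟩
      rw [Complex.ofReal_inv] at h4
      exact sub_eq_iff_eq_add.1 h4
    rw [ContinuousLinearMap.mul_def, ContinuousLinearMap.comp_apply, hval]
    simp only [smul_apply, add_apply,
      one_apply_eq_self]
    rw [map_smul, h5, smul_smul, mul_inv_cancel₀ hs0, one_smul]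
    abel
  · ext V
    have h3 := h2 ⟨R V, h.mem V⟩
    rw [h.apply_inverse] at h3
    rw [ContinuousLinearMap.mul_def, ContinuousLinearMap.comp_apply, hval]
    simp only [smul_apply, add_apply,
      one_apply_eq_self]
    rw [← map_smul, smul_sub, smul_smul, inv_mul_cancel₀ hs0, one_smul, ← Complex.ofReal_inv, h3,
      sub_add_cancel, smul_smul, Complex.ofReal_inv, inv_mul_cancel₀ hs0, one_smul]

lemma exists_isPositiveSqrt (h : HasInverse T R) (hR : 0 ≤ R) :
    ∃ Λ : 𝒳 →ₗ.[ℂ] 𝒳, IsPositiveSqrt Λ T := by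
  have hS : CFC.sqrt R * CFC.sqrt R = R := CFC.sqrt_mul_sqrt_self R hR
  have hS0 : 0 ≤ CFC.sqrt R := CFC.sqrt_nonneg R
  set S := CFC.sqrt R
  have hinj : Function.Injective S := by
    intro x y e
    apply h.injective
    rw [← hS]
    exact congrArg S e
  obtain ⟨Λ, hΛ⟩ := exists_of_injective hinj
  refine ⟨Λ, hΛ.isSelfAdjoint hS0.isSelfAdjoint, fun x => ?_, ?_⟩
  · have := ((ContinuousLinearMap.nonneg_iff_isPositive S).1 hS0).re_inner_nonneg_right (Λ x)
    rwa [hΛ.inverse_apply] at this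
  · refine (hΛ.comp hΛ).ext ?_
    rw [show S ∘L S = R from hS]
    exact h

/-- This treats an arbitrary square root, so no uniqueness theorem is needed. The inverse is `S = Λ
R`: it is symmetric and everywhere defined, hence bounded by Hellinger–Toeplitz. -/
lemma exists_of_isPositiveSqrt (h : HasInverse T R) {Λ : 𝒳 →ₗ.[ℂ] 𝒳} (hΛ : IsPositiveSqrt Λ T) :
    ∃ S : 𝒳 →L[ℂ] 𝒳, HasInverse Λ S ∧ IsSelfAdjoint S ∧ S ∘L S = R := by
  have h' : HasInverse (ComplexHamilton.comp Λ Λ) R := by rwa [hΛ.sq_eq]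
  have hinj : ∀ x : Λ.domain, Λ x = 0 → (x : 𝒳) = 0 := by
    intro x hx
    have h1 : R 0 = x := (h' x 0).1 ⟨⟨x.2, by rw [hx]; exact Λ.domain.zero_mem⟩, (congrArg Λ (Subtype.ext hx :
      (⟨Λ x, by rw [hx]; exact Λ.domain.zero_mem⟩ : Λ.domain) = 0)).trans Λ.map_zero⟩
    rw [← h1, map_zero]
  have hm : ∀ W, R W ∈ Λ.domain := fun W => (h'.mem W).1
  let S₀ : 𝒳 →ₗ[ℂ] 𝒳 := Λ.toFun ∘ₗ ((R : 𝒳 →ₗ[ℂ] 𝒳).codRestrict Λ.domain hm)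
  have hS₀ : ∀ Z W : 𝒳, (∃ h : Z ∈ Λ.domain, Λ ⟨Z, h⟩ = W) ↔ S₀ W = Z := by
    have h1 : ∀ W, ∃ h : S₀ W ∈ Λ.domain, Λ ⟨S₀ W, h⟩ = W :=
      fun W => ⟨(h'.mem W).2, h'.apply_inverse W⟩
    intro Z W
    constructor
    · rintro ⟨h2, h3⟩
      obtain ⟨h4, h5⟩ := h1 W
      have := hinj (⟨S₀ W, h4⟩ - ⟨Z, h2⟩) (by rw [LinearPMap.map_sub, h3, h5, sub_self])
      exact sub_eq_zero.1 this
    · rintro rfl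
      exact h1 W
  have hsymm : S₀.IsSymmetric := by
    intro x y
    have h0 : Λ.adjoint = Λ := LinearPMap.isSelfAdjoint_def.1 hΛ.selfAdjoint
    have hf : Λ.IsFormalAdjoint Λ := by
      have := LinearPMap.adjoint_isFormalAdjoint hΛ.selfAdjoint.dense_domain
      rwa [h0] at this
    obtain ⟨h1, h2⟩ := (hS₀ _ x).2 rfl
    obtain ⟨h3, h4⟩ := (hS₀ _ y).2 rfl
    have := hf ⟨S₀ x, h1⟩ ⟨S₀ y, h3⟩
    rw [h2, h4] at this
    exact this.symm
  let S : 𝒳 →L[ℂ] 𝒳 := ⟨S₀, hsymm.continuous⟩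
  have hS : HasInverse Λ S := hS₀
  refine ⟨S, hS, ContinuousLinearMap.isSelfAdjoint_iff_isSymmetric.2 hsymm, ?_⟩
  ext W
  exact ((hS.comp hS _ W).1 ⟨h'.mem W, h'.apply_inverse W⟩)

end HasInverse

end BoundedInverse

/-! ### Spectral projections of `K⁻¹` from the continuous functional calculus of `K`. -/

section SpectralProjections

variable {𝒳 : Type*} [NormedAddCommGroup 𝒳] [InnerProductSpace ℂ 𝒳]

lemma abs_re_inner_le (x y : 𝒳) : |(inner ℂ x y).re| ≤ ‖x‖ * ‖y‖ :=
  (Complex.abs_re_le_norm _).trans (norm_inner_le_norm _ _)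

lemma re_inner_self (x : 𝒳) : (inner ℂ x x).re = ‖x‖ ^ 2 := by
  rw [inner_self_eq_norm_sq_to_K]
  norm_cast

lemma re_inner_real_smul_left (c : ℝ) (x y : 𝒳) :
    (inner ℂ ((c : ℂ) • x) y).re = c * (inner ℂ x y).re := by
  rw [inner_smul_left, Complex.conj_ofReal, Complex.re_ofReal_mul]

variable [CompleteSpace 𝒳]

section Calculus

variable {K : 𝒳 →L[ℂ] 𝒳} {f g : ℝ → ℝ}

lemma cfc_apply_cfc (hf : Continuous f) (hg : Continuous g) (z : 𝒳) :
    cfc f K (cfc g K z) = cfc (fun x => f x * g x) K z := by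
  rw [cfc_mul f g K hf.continuousOn hg.continuousOn]
  rfl

lemma cfc_apply_comm (z : 𝒳) : cfc f K (cfc g K z) = cfc g K (cfc f K z) :=
  DFunLike.congr_fun (cfc_commute_cfc f g K).eq z

lemma cfc_sub_apply (hf : Continuous f) (hg : Continuous g) (z : 𝒳) :
    cfc (fun x => f x - g x) K z = cfc f K z - cfc g K z := by
  rw [cfc_sub f g K hf.continuousOn hg.continuousOn]
  rfl

lemma isSelfAdjoint_cfc : IsSelfAdjoint (cfc f K) := cfc_predicate f K

lemma re_inner_cfc_nonneg (h : ∀ x, 0 ≤ f x) (z : 𝒳) : 0 ≤ (inner ℂ (cfc f K z) z).re :=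
  ((ContinuousLinearMap.nonneg_iff_isPositive (cfc f K)).1
    (cfc_nonneg fun x _ => h x)).re_inner_nonneg_left z

/-- `g² - f² ≥ 0` gives a nonnegative operator, whose quadratic form is `‖g(K) z‖² - ‖f(K) z‖²`. In
this way scalar inequalities become inclusions of kernels. -/
lemma norm_cfc_apply_le (hf : Continuous f) (hg : Continuous g) (h : ∀ x, |f x| ≤ |g x|)
    (z : 𝒳) : ‖cfc f K z‖ ≤ ‖cfc g K z‖ := by
  have h1 := re_inner_cfc_nonneg (K := K) (f := fun x => g x * g x - f x * f x)
    (fun x => sub_nonneg.2 (abs_le_iff_mul_self_le.1 (h x))) z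
  rw [cfc_sub_apply (by fun_prop) (by fun_prop), ← cfc_apply_cfc hg hg, ← cfc_apply_cfc hf hf,
    inner_sub_left, (isSelfAdjoint_cfc (f := g)).inner_map_left (cfc g K z),
    (isSelfAdjoint_cfc (f := f)).inner_map_left (cfc f K z), Complex.sub_re, re_inner_self,
    re_inner_self] at h1
  exact le_of_sq_le_sq (sub_nonneg.1 h1) (norm_nonneg _)

lemma cfc_apply_eq_zero (hf : Continuous f) (hg : Continuous g) (h : ∀ x, |f x| ≤ |g x|)
    {z : 𝒳} (hz : cfc g K z = 0) : cfc f K z = 0 := by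
  have := norm_cfc_apply_le (K := K) hf hg h z
  rw [hz, norm_zero] at this
  exact norm_le_zero_iff.1 this

/-- A selfadjoint operator that leaves `U` invariant also leaves its orthogonal complement
invariant. -/
lemma _root_.IsSelfAdjoint.commute_starProjection {A : 𝒳 →L[ℂ] 𝒳} (hA : IsSelfAdjoint A)
    (U : Submodule ℂ 𝒳) [U.HasOrthogonalProjection] (h : ∀ u ∈ U, A u ∈ U) (z : 𝒳) :
    A (U.starProjection z) = U.starProjection (A z) := by
  refine (U.eq_starProjection_of_mem_of_inner_eq_zero
    (h _ (U.starProjection_apply_mem z)) fun w hw => ?_).symm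
  rw [← map_sub, hA.inner_map_left]
  exact U.starProjection_inner_eq_zero z _ (h w hw)

end Calculus

/-- The positive part of `κ - ω κ²`, which for `κ ≠ 0` vanishes if and only if `κ⁻¹ ≤ ω`. -/
def upperCut (ω κ : ℝ) : ℝ := max (κ - ω * κ ^ 2) 0

/-- The negative part of `κ - ω κ²`, which for `κ ≠ 0` vanishes if and only if `ω ≤ κ⁻¹`. -/
def lowerCut (ω κ : ℝ) : ℝ := max (ω * κ ^ 2 - κ) 0

@[fun_prop]
lemma continuous_upperCut (ω : ℝ) : Continuous (upperCut ω) := by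
  unfold upperCut
  fun_prop

@[fun_prop]
lemma continuous_lowerCut (ω : ℝ) : Continuous (lowerCut ω) := by
  unfold lowerCut
  fun_prop

lemma upperCut_nonneg (ω κ : ℝ) : 0 ≤ upperCut ω κ := le_max_right _ _

lemma lowerCut_nonneg (ω κ : ℝ) : 0 ≤ lowerCut ω κ := le_max_right _ _

lemma upperCut_sub_lowerCut (ω κ : ℝ) : upperCut ω κ - lowerCut ω κ = κ - ω * κ ^ 2 := by
  unfold upperCut lowerCut
  rcases le_total (κ - ω * κ ^ 2) 0 with h | h
  · rw [max_eq_right h, max_eq_left (by linarith)]; ring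
  · rw [max_eq_left h, max_eq_right (by linarith)]; ring

lemma upperCut_mul_lowerCut (ω κ : ℝ) : upperCut ω κ * lowerCut ω κ = 0 := by
  unfold upperCut lowerCut
  rcases le_total (κ - ω * κ ^ 2) 0 with h | h
  · rw [max_eq_right h, zero_mul]
  · rw [max_eq_right (a := ω * κ ^ 2 - κ) (by linarith), mul_zero]

lemma upperCut_anti {ω ω' : ℝ} (h : ω ≤ ω') (κ : ℝ) : |upperCut ω' κ| ≤ |upperCut ω κ| := by
  rw [abs_of_nonneg (upperCut_nonneg _ _), abs_of_nonneg (upperCut_nonneg _ _)]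
  exact max_le_max (by nlinarith [sq_nonneg κ]) le_rfl

lemma abs_upperCut_sub_le (ω ω' κ : ℝ) :
    |upperCut ω κ - upperCut ω' κ| ≤ |(ω - ω') * (κ * κ)| := by
  refine (abs_max_sub_max_le_abs _ _ _).trans (le_of_eq ?_)
  rw [← abs_neg]
  congr 1
  ring

/-- An everywhere defined continuous function equal to `κ⁻¹` for `r ≤ |κ|`. -/
def cutInv (r κ : ℝ) : ℝ := κ / max (κ ^ 2) (r ^ 2)

lemma continuous_cutInv {r : ℝ} (hr : 0 < r) : Continuous (cutInv r) := by
  unfold cutInv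
  refine continuous_id.div (by fun_prop) fun κ => ne_of_gt ?_
  exact lt_of_lt_of_le (by positivity) (le_max_right _ _)

/-- The left side vanishes for `r ≤ |κ|`. For `|κ| = c r` with `c < 1` it equals `c r (1 - c²)`,
while one of the cuts is at least `c r (1 - c)`; the factor `2` absorbs `1 + c`. Consequently
`cutInv r` inverts `K` on vectors killed by both cuts, although `K⁻¹` is unbounded. -/
lemma abs_mul_cutInv_sub_one_le {r p q : ℝ} (hr : 0 < r) (hp : |p| * r ≤ 1) (hq : |q| * r ≤ 1)
    (κ : ℝ) :
    |κ * (κ * cutInv r κ - 1)| ≤ |2 * lowerCut p κ + 2 * upperCut q κ| := by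
  have hl := lowerCut_nonneg p κ
  have hu := upperCut_nonneg q κ
  rw [abs_of_nonneg (a := 2 * lowerCut p κ + _) (by positivity)]
  unfold cutInv
  rcases le_or_gt r |κ| with h | h
  · have h1 : r ^ 2 ≤ κ ^ 2 := sq_le_sq.2 (by rwa [abs_of_pos hr])
    have h2 : κ ^ 2 ≠ 0 := ne_of_gt (lt_of_lt_of_le (by positivity) h1)
    rw [max_eq_left h1, show κ * (κ / κ ^ 2) - 1 = 0 by
      rw [← mul_div_assoc, ← pow_two, div_self h2, sub_self], mul_zero, abs_zero]
    positivity
  · have h1 : κ ^ 2 ≤ r ^ 2 := sq_le_sq.2 (by rw [abs_of_pos hr]; exact h.le)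
    rw [max_eq_right h1]
    set c := |κ| / r with hc
    have hc0 : 0 ≤ c := by positivity
    have hc1 : c ≤ 1 := (div_le_one hr).2 h.le
    have hκ : κ * (κ / r ^ 2) - 1 = c ^ 2 - 1 := by
      rw [hc, div_pow, sq_abs]; ring
    have hab : |κ| = c * r := by rw [hc]; field_simp
    rw [hκ, abs_mul, abs_of_nonpos (a := c ^ 2 - 1) (by nlinarith), hab]
    have hκ2 : κ ^ 2 = c ^ 2 * r ^ 2 := by rw [← sq_abs, hab]; ring
    have hcr : 0 ≤ c * r * (1 - c) ^ 2 := by positivity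
    rcases le_total 0 κ with h2 | h2
    · have h3 : κ - q * κ ^ 2 ≤ upperCut q κ := le_max_left _ _
      have h4 : q * r ≤ 1 := le_trans (by gcongr; exact le_abs_self q) hq
      rw [abs_of_nonneg h2] at hab
      have h5 : c ^ 2 * r * (q * r) ≤ c ^ 2 * r * 1 := by gcongr
      nlinarith
    · have h3 : p * κ ^ 2 - κ ≤ lowerCut p κ := le_max_left _ _
      have h4 : -1 ≤ p * r := by
        have : -p * r ≤ 1 := le_trans (by gcongr; exact neg_le_abs p) hp
        linarith
      rw [abs_of_nonpos h2] at hab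
      have h5 : c ^ 2 * r * (-1) ≤ c ^ 2 * r * (p * r) := by gcongr
      nlinarith

/-- The spectral projection of the inverse of `K` that belongs to `(-∞, ω]`. -/
def spectralProj (K : 𝒳 →L[ℂ] 𝒳) (ω : ℝ) : 𝒳 →L[ℂ] 𝒳 :=
  (cfc (upperCut ω) K).ker.starProjection

section SpectralProj

variable {K : 𝒳 →L[ℂ] 𝒳}

lemma mem_ker_upperCut {ω : ℝ} {z : 𝒳} :
    z ∈ (cfc (upperCut ω) K).ker ↔ cfc (upperCut ω) K z = 0 := Iff.rfl

lemma upperCut_spectralProj (ω : ℝ) (z : 𝒳) : cfc (upperCut ω) K (spectralProj K ω z) = 0 :=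
  mem_ker_upperCut.1 (Submodule.starProjection_apply_mem _ z)

lemma spectralProj_of_upperCut {ω : ℝ} {z : 𝒳} (h : cfc (upperCut ω) K z = 0) :
    spectralProj K ω z = z :=
  Submodule.starProjection_eq_self_iff.2 (mem_ker_upperCut.2 h)

lemma isStarProjection_spectralProj (ω : ℝ) : IsStarProjection (spectralProj K ω) :=
  isStarProjection_starProjection

lemma cfc_spectralProj (f : ℝ → ℝ) (ω : ℝ) (z : 𝒳) :
    cfc f K (spectralProj K ω z) = spectralProj K ω (cfc f K z) := by
  refine isSelfAdjoint_cfc.commute_starProjection _ (fun u hu => ?_) z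
  rw [mem_ker_upperCut] at hu ⊢
  rw [cfc_apply_comm, hu, map_zero]

lemma commute_spectralProj (hK : IsSelfAdjoint K) (ω : ℝ) (z : 𝒳) :
    K (spectralProj K ω z) = spectralProj K ω (K z) := by
  have := cfc_spectralProj (K := K) (fun x => x) ω z
  rwa [cfc_id' ℝ K hK] at this

lemma upperCut_spectralProj_of_le {ω ω' : ℝ} (h : ω ≤ ω') (z : 𝒳) :
    cfc (upperCut ω') K (spectralProj K ω z) = 0 :=
  cfc_apply_eq_zero (by fun_prop) (by fun_prop) (upperCut_anti h) (upperCut_spectralProj ω z)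

lemma spectralProj_spectralProj {ω ω' : ℝ} (h : ω ≤ ω') (z : 𝒳) :
    spectralProj K ω' (spectralProj K ω z) = spectralProj K ω z :=
  spectralProj_of_upperCut (upperCut_spectralProj_of_le h z)

lemma spectralProj_spectralProj' {ω ω' : ℝ} (h : ω ≤ ω') (z : 𝒳) :
    spectralProj K ω (spectralProj K ω' z) = spectralProj K ω z := by
  have h1 : ∀ ω, IsSelfAdjoint (spectralProj K ω) := fun ω =>
    (isStarProjection_spectralProj ω).isSelfAdjoint
  refine ext_inner_right ℂ fun v => ?_
  rw [(h1 ω).inner_map_left, (h1 ω').inner_map_left, spectralProj_spectralProj h,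
    (h1 ω).inner_map_left]

/-- The two cuts have product zero, so the range of the lower cut lies in the kernel of the upper
one and is fixed by the projection. -/
lemma lowerCut_sub_spectralProj (ω : ℝ) (z : 𝒳) :
    cfc (lowerCut ω) K (z - spectralProj K ω z) = 0 := by
  rw [map_sub, cfc_spectralProj, sub_eq_zero]
  refine (spectralProj_of_upperCut ?_).symm
  rw [cfc_apply_cfc (by fun_prop) (by fun_prop)]
  simp only [upperCut_mul_lowerCut]
  rw [cfc_const_zero]
  rfl

lemma lowerCut_of_spectralProj_eq_zero {ω : ℝ} {z : 𝒳} (h : spectralProj K ω z = 0) :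
    cfc (lowerCut ω) K z = 0 := by
  simpa [h] using lowerCut_sub_spectralProj (K := K) ω z

lemma upperCut_sub_lowerCut_apply (hK : IsSelfAdjoint K) (ω : ℝ) (z : 𝒳) :
    cfc (upperCut ω) K z - cfc (lowerCut ω) K z = K z - (ω : ℂ) • K (K z) := by
  rw [← cfc_sub_apply (by fun_prop) (by fun_prop)]
  simp only [upperCut_sub_lowerCut]
  rw [cfc_sub_apply (by fun_prop) (by fun_prop), cfc_id' ℝ K hK,
    cfc_const_mul ω (fun x => x ^ 2) K, cfc_pow_id K 2 hK, pow_two, Complex.coe_smul]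
  rfl

lemma norm_le_of_cut {C N : ℝ} (hC : 0 ≤ C) (hN : 0 ≤ N) {ω : ℝ} (h : ω * C ^ 2 ≤ C * N)
    (hω : 0 < ω) : C ≤ N / ω := by
  rw [le_div_iff₀ hω]
  rcases hC.eq_or_lt with rfl | hC'
  · simpa using hN
  · nlinarith

/-- On such `z` the form of `K - ω K²` is nonnegative, so `ω ‖K z‖² ≤ ‖K z‖ ‖z‖`. This is the decay
behind the limit of the projections at `∞`. -/
lemma norm_apply_le_of_lowerCut (hK : IsSelfAdjoint K) {ω : ℝ} (hω : 0 < ω) {z : 𝒳}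
    (hz : cfc (lowerCut ω) K z = 0) : ‖K z‖ ≤ ‖z‖ / ω := by
  refine norm_le_of_cut (norm_nonneg _) (norm_nonneg _) ?_ hω
  have h1 := re_inner_cfc_nonneg (K := K) (upperCut_nonneg ω) z
  have h2 := upperCut_sub_lowerCut_apply hK ω z
  rw [hz, sub_zero] at h2
  rw [h2, inner_sub_left, Complex.sub_re, re_inner_real_smul_left, hK.inner_map_left (K z),
    re_inner_self] at h1
  have h3 := (le_abs_self _).trans (abs_re_inner_le (K z) z)
  linarith

lemma norm_apply_le_of_upperCut (hK : IsSelfAdjoint K) {ω : ℝ} (hω : ω < 0) {z : 𝒳}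
    (hz : cfc (upperCut ω) K z = 0) : ‖K z‖ ≤ ‖z‖ / (-ω) := by
  refine norm_le_of_cut (norm_nonneg _) (norm_nonneg _) ?_ (neg_pos.2 hω)
  have h1 := re_inner_cfc_nonneg (K := K) (lowerCut_nonneg ω) z
  have h2 := upperCut_sub_lowerCut_apply hK ω z
  rw [hz, zero_sub, neg_eq_iff_eq_neg] at h2
  rw [h2, inner_neg_left, inner_sub_left, Complex.neg_re, Complex.sub_re,
    re_inner_real_smul_left, hK.inner_map_left (K z), re_inner_self] at h1
  have h3 := (neg_le_abs _).trans (abs_re_inner_le (K z) z)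
  linarith

end SpectralProj

end SpectralProjections

/-! ### The projections form a spectral family and localize the inverse of `K`. -/

section SpectralFamilyOfInverse

variable {𝒳 : Type*} [NormedAddCommGroup 𝒳] [InnerProductSpace ℂ 𝒳]

lemma tendsto_zero_of_mem_closure {ι : Type*} {l : Filter ι} {A : ι → 𝒳 →L[ℂ] 𝒳}
    (hA : ∀ i z, ‖A i z‖ ≤ ‖z‖) {S : Set 𝒳}
    (hS : ∀ u ∈ S, Tendsto (fun i => A i u) l (𝓝 0)) {z : 𝒳} (hz : z ∈ closure S) :
    Tendsto (fun i => A i z) l (𝓝 0) := by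
  rw [Metric.tendsto_nhds]
  intro ε hε
  obtain ⟨u, hu, hd⟩ := Metric.mem_closure_iff.1 hz (ε / 2) (half_pos hε)
  filter_upwards [Metric.tendsto_nhds.1 (hS u hu) (ε / 2) (half_pos hε)] with i hi
  rw [dist_zero_right] at hi ⊢
  rw [dist_eq_norm] at hd
  calc ‖A i z‖ = ‖A i (z - u) + A i u‖ := by rw [map_sub, sub_add_cancel]
    _ ≤ ‖z - u‖ + ‖A i u‖ := (norm_add_le _ _).trans (by gcongr; exact hA _ _)
    _ < ε := by linarith

/-- If `d ≤ e`, the hypotheses give `(x - e n)(x + d n) ≤ 0`, hence `x ≤ e n`; the other case is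
symmetric. -/
lemma norm_le_of_quadratic {x n r d e : ℝ} (hn : 0 ≤ n) (hd : 0 ≤ d) (he : 0 ≤ e)
    (hr : |r| ≤ x * n) (h : x ^ 2 + (d - e) * r - d * e * n ^ 2 ≤ 0) : x ≤ (d + e) * n := by
  by_contra! hlt
  have hr' := abs_le.1 hr
  have hx0 : 0 < x := lt_of_le_of_lt (by positivity) hlt
  rcases le_total d e with hde | hde
  · have h1 : (e - d) * r ≤ (e - d) * (x * n) := by
      apply mul_le_mul_of_nonneg_left hr'.2 (by linarith)
    nlinarith [mul_pos hx0 (sub_pos.2 hlt), mul_nonneg hd hn, mul_nonneg he hn,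
      mul_nonneg (mul_nonneg hd hn) (sub_nonneg.2 hlt.le), mul_nonneg (mul_nonneg hd hn)
      (mul_nonneg hd hn), mul_nonneg (mul_nonneg hd hn) (mul_nonneg he hn)]
  · have h1 : (d - e) * (-r) ≤ (d - e) * (x * n) := by
      apply mul_le_mul_of_nonneg_left _ (by linarith)
      linarith
    nlinarith [mul_pos hx0 (sub_pos.2 hlt), mul_nonneg hd hn, mul_nonneg he hn,
      mul_nonneg (mul_nonneg he hn) (sub_nonneg.2 hlt.le), mul_nonneg (mul_nonneg he hn)
      (mul_nonneg he hn), mul_nonneg (mul_nonneg hd hn) (mul_nonneg he hn)]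

/-- For `v = H z` the hypothesis says that `(H - p)(H - q)` has nonpositive form at `z`, that is,
`z` is spectrally supported in `[p, q]`. -/
lemma norm_sub_smul_le_of_re_inner {v z : 𝒳} {p c q : ℝ} (hp : p ≤ c) (hq : c ≤ q)
    (h : (inner ℂ (v - (p : ℂ) • z) (v - (q : ℂ) • z)).re ≤ 0) :
    ‖v - (c : ℂ) • z‖ ≤ (q - p) * ‖z‖ := by
  have e1 : v - (p : ℂ) • z = (v - (c : ℂ) • z) + ((c - p : ℝ) : ℂ) • z := by
    push_cast
    module
  have e2 : v - (q : ℂ) • z = (v - (c : ℂ) • z) - ((q - c : ℝ) : ℂ) • z := by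
    push_cast
    module
  rw [e1, e2] at h
  generalize v - (c : ℂ) • z = x at *
  rw [show q - p = (c - p) + (q - c) by ring]
  refine norm_le_of_quadratic (r := (inner ℂ x z).re) (norm_nonneg _)
    (sub_nonneg.2 hp) (sub_nonneg.2 hq) (abs_re_inner_le x z) (le_trans (le_of_eq ?_) h)
  rw [inner_add_left, inner_sub_right, inner_sub_right, Complex.add_re, Complex.sub_re,
    Complex.sub_re, re_inner_self, re_inner_real_smul_left, re_inner_real_smul_left,
    inner_smul_right, inner_smul_right, Complex.re_ofReal_mul, Complex.re_ofReal_mul,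
    re_inner_self, ← inner_conj_symm z x, Complex.conj_re]
  ring

variable [CompleteSpace 𝒳]

section StarProjection

variable {P : 𝒳 →L[ℂ] 𝒳}

lemma _root_.IsStarProjection.apply_apply (hP : IsStarProjection P) (z : 𝒳) : P (P z) = P z :=
  DFunLike.congr_fun hP.isIdempotentElem z

lemma _root_.IsStarProjection.inner_left (hP : IsStarProjection P) (x y : 𝒳) :
    inner ℂ (P x) y = inner ℂ x (P y) :=
  hP.isSelfAdjoint.inner_map_left x y

lemma _root_.IsStarProjection.norm_apply_le (hP : IsStarProjection P) (z : 𝒳) : ‖P z‖ ≤ ‖z‖ := by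
  have := P.le_of_opNorm_le (IsStarProjection.norm_le P hP) z
  rwa [one_mul] at this

end StarProjection

variable {K : 𝒳 →L[ℂ] 𝒳}

lemma norm_sub_spectralProj_le (ω : ℝ) (z : 𝒳) : ‖z - spectralProj K ω z‖ ≤ ‖z‖ :=
  IsStarProjection.norm_apply_le (P := 1 - spectralProj K ω)
    (isStarProjection_spectralProj ω).one_sub z

/-- The core of right continuity. The vector `z - E ω z` lies in the closure of the range of the
upper cut at `ω`. On that range `E s` removes the upper cut at `s`, and the two cuts differ by at
most `|ω - s| κ²`. -/
lemma tendsto_spectralProj_sub (hK : IsSelfAdjoint K) (ω : ℝ) (z : 𝒳) :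
    Tendsto (fun s => spectralProj K s (z - spectralProj K ω z)) (𝓝[>] ω) (𝓝 0) := by
  have hmem : z - spectralProj K ω z ∈ closure (range (cfc (upperCut ω) K : 𝒳 →L[ℂ] 𝒳)) := by
    have h1 : z - spectralProj K ω z ∈ (cfc (upperCut ω) K).kerᗮ :=
      Submodule.sub_starProjection_mem_orthogonal z
    rw [ContinuousLinearMap.orthogonal_ker, ← ContinuousLinearMap.star_eq_adjoint,
      (isSelfAdjoint_cfc (f := upperCut ω) (K := K)).star_eq] at h1
    exact h1
  refine tendsto_zero_of_mem_closure
    (fun s z => (isStarProjection_spectralProj (K := K) s).norm_apply_le z) ?_ hmem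
  rintro _ ⟨u, rfl⟩
  have hb : ∀ s, ‖spectralProj K s (cfc (upperCut ω) K u)‖ ≤ |ω - s| * ‖K (K u)‖ := by
    intro s
    have h1 : spectralProj K s (cfc (upperCut ω) K u) =
        spectralProj K s (cfc (fun x => upperCut ω x - upperCut s x) K u) := by
      rw [cfc_sub_apply (by fun_prop) (by fun_prop), map_sub,
        ← cfc_spectralProj (upperCut s), upperCut_spectralProj, sub_zero]
    rw [h1]
    refine ((isStarProjection_spectralProj (K := K) s).norm_apply_le _).trans ?_
    refine (norm_cfc_apply_le (K := K) (by fun_prop) (g := fun x => (ω - s) * (x * x))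
      (by fun_prop) (abs_upperCut_sub_le ω s) u).trans (le_of_eq ?_)
    rw [cfc_const_mul (ω - s) (fun x => x * x) K, cfc_mul (fun x => x) (fun x => x) K,
      cfc_id' ℝ K hK, smul_apply, norm_smul, Real.norm_eq_abs]
    rfl
  refine squeeze_zero_norm hb ?_
  have : Tendsto (fun s => |ω - s| * ‖K (K u)‖) (𝓝 ω) (𝓝 (|ω - ω| * ‖K (K u)‖)) := by
    apply Continuous.tendsto
    fun_prop
  rw [sub_self, abs_zero, zero_mul] at this
  exact this.mono_left nhdsWithin_le_nhds

lemma isSpectralFamily_spectralProj (hK : IsSelfAdjoint K) (hinj : Function.Injective K) :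
    IsSpectralFamily (spectralProj K) where
  projection := isStarProjection_spectralProj
  monotone ω ω' h := by
    ext z
    exact spectralProj_spectralProj' h z
  rightContinuous ω z := by
    have h1 := (tendsto_spectralProj_sub hK ω z).add_const (spectralProj K ω z)
    rw [zero_add] at h1
    refine h1.congr' ?_
    filter_upwards [self_mem_nhdsWithin] with s hs
    rw [map_sub, spectralProj_spectralProj (le_of_lt hs), sub_add_cancel]
  atBot z := by
    refine tendsto_zero_of_mem_closure
      (fun s z => (isStarProjection_spectralProj (K := K) s).norm_apply_le z) ?_
      -- It suffices to treat vectors `K u`, on which `E ω` has norm at most `‖u‖ / |ω|`.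
      (hK.denseRange_of_injective hinj z)
    rintro _ ⟨u, rfl⟩
    refine squeeze_zero_norm' (a := fun ω => ‖u‖ / (-ω)) ?_
      (tendsto_neg_atBot_atTop.const_div_atTop _)
    filter_upwards [eventually_lt_atBot 0] with ω hω
    rw [← commute_spectralProj hK]
    refine (norm_apply_le_of_upperCut hK hω (upperCut_spectralProj ω u)).trans ?_
    have : 0 < -ω := neg_pos.2 hω
    gcongr
    exact (isStarProjection_spectralProj (K := K) ω).norm_apply_le u
  atTop z := by
    have h1 : Tendsto (fun ω => (1 - spectralProj K ω) z) atTop (𝓝 0) := by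
      refine tendsto_zero_of_mem_closure
        (fun s z => norm_sub_spectralProj_le s z) ?_
        (hK.denseRange_of_injective hinj z)
      rintro _ ⟨u, rfl⟩
      refine squeeze_zero_norm' (a := fun ω => ‖u‖ / ω) ?_ (tendsto_id.const_div_atTop _)
      filter_upwards [eventually_gt_atTop 0] with ω hω
      change ‖K u - spectralProj K ω (K u)‖ ≤ _
      rw [← commute_spectralProj hK, ← map_sub]
      refine (norm_apply_le_of_lowerCut hK hω (lowerCut_sub_spectralProj ω u)).trans ?_
      gcongr
      exact norm_sub_spectralProj_le ω u
    have h2 := h1.const_sub z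
    rw [sub_zero] at h2
    refine h2.congr fun ω => ?_
    change z - (z - spectralProj K ω z) = _
    abel

/-- The increments of `E` commute with `K` and reduce the inverse `H` of `K`, and on the range
of `E q - E p` the operator `H` differs from any `c ∈ [p, q]` by at most `q - p`. -/
structure Localizes (E : ℝ → 𝒳 →L[ℂ] 𝒳) (K : 𝒳 →L[ℂ] 𝒳) : Prop where
  commute : ∀ ω z, K (E ω z) = E ω (K z)
  exists_preimage : ∀ {p c q : ℝ}, p ≤ c → c ≤ q → ∀ z, ∃ V, K V = (E q - E p) z ∧
    ‖V - (c : ℂ) • (E q - E p) z‖ ≤ (q - p) * ‖(E q - E p) z‖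

/-- Here `K z - p K² z` is the upper cut at `p` and `K z - q K² z` is minus the lower cut at `q`;
the product of the two cuts is nonnegative. -/
lemma re_inner_cut_le (hK : IsSelfAdjoint K) {p q : ℝ} {z : 𝒳}
    (hp : cfc (lowerCut p) K z = 0) (hq : cfc (upperCut q) K z = 0) :
    (inner ℂ (K z - (p : ℂ) • K (K z)) (K z - (q : ℂ) • K (K z))).re ≤ 0 := by
  rw [← upperCut_sub_lowerCut_apply hK, ← upperCut_sub_lowerCut_apply hK, hp, hq, sub_zero,
    zero_sub, inner_neg_right, ← isSelfAdjoint_cfc.inner_map_left,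
    cfc_apply_cfc (by fun_prop) (by fun_prop), Complex.neg_re]
  exact neg_nonpos.2 (re_inner_cfc_nonneg
    (fun x => mul_nonneg (lowerCut_nonneg _ _) (upperCut_nonneg _ _)) z)

lemma exists_preimage_of_cut (hK : IsSelfAdjoint K) (hinj : Function.Injective K) {p q : ℝ} {z : 𝒳}
    (hp : cfc (lowerCut p) K z = 0) (hq : cfc (upperCut q) K z = 0) :
    ∃ V, K V = z ∧ cfc (lowerCut p) K V = 0 ∧ cfc (upperCut q) K V = 0 := by
  obtain ⟨r, hr, hpr, hqr⟩ : ∃ r > 0, |p| * r ≤ 1 ∧ |q| * r ≤ 1 := by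
    refine ⟨(|p| + |q| + 1)⁻¹, by positivity, ?_, ?_⟩
    · rw [← div_eq_mul_inv, div_le_one (by positivity)]
      linarith [abs_nonneg q]
    · rw [← div_eq_mul_inv, div_le_one (by positivity)]
      linarith [abs_nonneg p]
  have hc := continuous_cutInv hr
  refine ⟨cfc (cutInv r) K z, hinj (sub_eq_zero.1 ?_), ?_, ?_⟩
  · have h1 : cfc (fun κ => κ * (κ * cutInv r κ - 1)) K z = 0 := by
      refine cfc_apply_eq_zero (by fun_prop) (g := fun κ => 2 * lowerCut p κ + 2 * upperCut q κ)
        (by fun_prop) (abs_mul_cutInv_sub_one_le hr hpr hqr) ?_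
      rw [cfc_add (R := ℝ) K (fun κ => 2 * lowerCut p κ) (fun κ => 2 * upperCut q κ)
        (Continuous.continuousOn (by fun_prop)) (Continuous.continuousOn (by fun_prop)), add_apply,
        cfc_const_mul (2 : ℝ) (lowerCut p) K (continuous_lowerCut p).continuousOn,
        cfc_const_mul (2 : ℝ) (upperCut q) K (continuous_upperCut q).continuousOn, smul_apply,
        smul_apply,
        hp, hq, smul_zero, add_zero]
    rw [← cfc_apply_cfc (f := fun x => x) (g := fun κ => κ * cutInv r κ - 1) (by fun_prop)
      (by fun_prop), cfc_sub_apply (f := fun κ => κ * cutInv r κ) (g := fun _ => 1) (by fun_prop)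
      (by fun_prop), ← cfc_apply_cfc (f := fun x => x) (g := cutInv r) (by fun_prop) hc,
      cfc_const_one ℝ K hK, cfc_id' ℝ K hK, map_sub] at h1
    exact h1
  · rw [cfc_apply_comm, hp, map_zero]
  · rw [cfc_apply_comm, hq, map_zero]

lemma localizes_spectralProj (hK : IsSelfAdjoint K) (hinj : Function.Injective K) :
    Localizes (spectralProj K) K where
  commute := commute_spectralProj hK
  exists_preimage {p c q} hpc hcq z := by
    have hpq := hpc.trans hcq
    have h1 : cfc (upperCut q) K ((spectralProj K q - spectralProj K p) z) = 0 := by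
      rw [sub_apply, map_sub, upperCut_spectralProj, upperCut_spectralProj_of_le hpq, sub_zero]
    have h2 : cfc (lowerCut p) K ((spectralProj K q - spectralProj K p) z) = 0 := by
      refine lowerCut_of_spectralProj_eq_zero ?_
      rw [sub_apply, map_sub, spectralProj_spectralProj' hpq, spectralProj_spectralProj le_rfl,
        sub_self]
    obtain ⟨V, hV, hV1, hV2⟩ := exists_preimage_of_cut hK hinj h2 h1
    -- A second preimage is needed because `re_inner_cut_le` compares `K V'` with `K (K V')`, which
    -- here are `V` and the localized vector.
    obtain ⟨V', hV', hV1', hV2'⟩ := exists_preimage_of_cut hK hinj hV1 hV2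
    refine ⟨V, hV, norm_sub_smul_le_of_re_inner hpc hcq ?_⟩
    have := re_inner_cut_le hK hV1' hV2'
    rwa [hV', hV] at this

end SpectralFamilyOfInverse

/-! ### Riemann–Stieltjes integrals against a spectral family. -/

section StieltjesIntegrals

lemma exists_partition {a b η : ℝ} (hab : a ≤ b) (hη : 0 < η) :
    ∃ (n : ℕ) (p : ℕ → ℝ), p 0 = a ∧ p n = b ∧ ∀ i < n, p i ≤ p (i + 1) ∧ p (i + 1) - p i < η := by
  obtain ⟨n, hn⟩ := exists_nat_gt ((b - a) / η)
  have hn0 : (0 : ℝ) < n := lt_of_le_of_lt (div_nonneg (sub_nonneg.2 hab) hη.le) hn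
  have hstep : ∀ i : ℕ, (a + ((i + 1 : ℕ) : ℝ) * ((b - a) / n)) - (a + (i : ℝ) * ((b - a) / n)) =
      (b - a) / n := fun i => by
    push_cast
    ring
  refine ⟨n, fun i => a + (i : ℝ) * ((b - a) / n), by simp, ?_, fun i _ => ⟨?_, ?_⟩⟩
  · change a + (n : ℝ) * ((b - a) / n) = b
    field_simp
    ring
  · rw [← sub_nonneg, hstep]
    exact div_nonneg (sub_nonneg.2 hab) hn0.le
  · rw [hstep, div_lt_iff₀ hn0]
    rwa [div_lt_iff₀ hη, mul_comm] at hn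

lemma le_of_forall_le_succ {n : ℕ} {p : ℕ → ℝ} (h : ∀ i < n, p i ≤ p (i + 1)) : p 0 ≤ p n := by
  induction n with
  | zero => exact le_rfl
  | succ n ih => exact (ih fun i hi => h i (by omega)).trans (h n (by omega))

variable {𝒳 : Type*} [NormedAddCommGroup 𝒳] [InnerProductSpace ℂ 𝒳]

namespace HasRSIntegral

variable {f : ℝ → ℂ} {F : ℝ → 𝒳} {a b : ℝ} {I I' : 𝒳}

lemma exists_sum (h : HasRSIntegral f F a b I) (hab : a ≤ b) {ε η : ℝ} (hε : 0 < ε)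
    (hη : 0 < η) : ∃ (n : ℕ) (p : ℕ → ℝ), p 0 = a ∧ p n = b ∧
      (∀ i < n, p i ≤ p (i + 1) ∧ p (i + 1) - p i < η) ∧
      ‖(∑ i ∈ Finset.range n, f (p i) • (F (p (i + 1)) - F (p i))) - I‖ < ε := by
  obtain ⟨η', hη', h'⟩ := h ε hε
  obtain ⟨n, p, h0, hn, hp⟩ := exists_partition hab (lt_min hη hη')
  exact ⟨n, p, h0, hn, fun i hi => ⟨(hp i hi).1, (hp i hi).2.trans_le (min_le_left _ _)⟩,
    h' n p p h0 hn fun i hi => ⟨left_mem_Icc.2 (hp i hi).1,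
      (hp i hi).2.trans_le (min_le_right _ _)⟩⟩

lemma unique (h : HasRSIntegral f F a b I) (h' : HasRSIntegral f F a b I') (hab : a ≤ b) :
    I = I' := by
  refine eq_of_norm_sub_le_zero (le_of_forall_pos_le_add fun ε hε => ?_)
  obtain ⟨η, hη, hs⟩ := h' (ε / 2) (half_pos hε)
  obtain ⟨n, p, h0, hn, hp, hsum⟩ := h.exists_sum hab (half_pos hε) hη
  have hsum' := hs n p p h0 hn fun i hi => ⟨left_mem_Icc.2 (hp i hi).1, (hp i hi).2⟩
  rw [norm_sub_rev] at hsum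
  have := norm_sub_le_norm_sub_add_norm_sub I
    (∑ i ∈ Finset.range n, f (p i) • (F (p (i + 1)) - F (p i))) I'
  linarith

lemma map (h : HasRSIntegral f F a b I) (L : 𝒳 →L[ℂ] 𝒳) :
    HasRSIntegral f (fun ω => L (F ω)) a b (L I) := by
  intro ε hε
  obtain ⟨η, hη, hs⟩ := h (ε / (‖L‖ + 1)) (by positivity)
  refine ⟨η, hη, fun n p ξ h0 hn hp => ?_⟩
  have h1 := hs n p ξ h0 hn hp
  have h2 : (∑ i ∈ Finset.range n, f (ξ i) • (L (F (p (i + 1))) - L (F (p i)))) - L I =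
      L ((∑ i ∈ Finset.range n, f (ξ i) • (F (p (i + 1)) - F (p i))) - I) := by
    simp only [map_sub, map_sum, map_smul]
  rw [h2]
  rw [lt_div_iff₀ (by positivity)] at h1
  refine (L.le_opNorm _).trans_lt (lt_of_le_of_lt ?_ h1)
  nlinarith [norm_nonneg ((∑ i ∈ Finset.range n, f (ξ i) • (F (p (i + 1)) - F (p i))) - I)]

end HasRSIntegral

lemma HasImproperRSIntegral.map {f : ℝ → ℂ} {F : ℝ → 𝒳} {I : 𝒳}
    (h : HasImproperRSIntegral f F I) (L : 𝒳 →L[ℂ] 𝒳) :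
    HasImproperRSIntegral f (fun ω => L (F ω)) (L I) := by
  obtain ⟨G, h1, h2⟩ := h
  exact ⟨fun a b => L (G a b), fun a b hab => (h1 a b hab).map L, (L.continuous.tendsto I).comp h2⟩

variable {E : ℝ → 𝒳 →L[ℂ] 𝒳} {K : 𝒳 →L[ℂ] 𝒳}

lemma Localizes.commute_sub (h : Localizes E K) (p q : ℝ) (z : 𝒳) :
    K ((E q - E p) z) = (E q - E p) (K z) := by
  rw [sub_apply, sub_apply, map_sub, h.commute, h.commute]

variable [CompleteSpace 𝒳]

namespace IsSpectralFamily

lemma apply_apply (hE : IsSpectralFamily E) {ω ω' : ℝ} (h : ω ≤ ω') (z : 𝒳) :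
    E ω (E ω' z) = E ω z :=
  DFunLike.congr_fun (hE.monotone ω ω' h) z

lemma apply_apply' (hE : IsSpectralFamily E) {ω ω' : ℝ} (h : ω ≤ ω') (z : 𝒳) :
    E ω' (E ω z) = E ω z := by
  refine ext_inner_right ℂ fun v => ?_
  rw [(hE.projection ω').inner_left, (hE.projection ω).inner_left, hE.apply_apply h,
    (hE.projection ω).inner_left]

lemma comm (hE : IsSpectralFamily E) (ω ω' : ℝ) (z : 𝒳) : E ω (E ω' z) = E ω' (E ω z) := by
  rcases le_total ω ω' with h | h
  · rw [hE.apply_apply h, hE.apply_apply' h]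
  · rw [hE.apply_apply h, hE.apply_apply' h]

lemma isStarProjection_sub (hE : IsSpectralFamily E) {p q : ℝ} (h : p ≤ q) :
    IsStarProjection (E q - E p) where
  isIdempotentElem := by
    ext z
    change E q (E q z - E p z) - E p (E q z - E p z) = E q z - E p z
    rw [map_sub, map_sub, hE.apply_apply h, hE.apply_apply' h, hE.apply_apply le_rfl,
      hE.apply_apply le_rfl, sub_self, sub_zero]
  isSelfAdjoint := (hE.projection q).isSelfAdjoint.sub (hE.projection p).isSelfAdjoint

lemma norm_sub_apply_le (hE : IsSpectralFamily E) {p q : ℝ} (h : p ≤ q) (z : 𝒳) :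
    ‖(E q - E p) z‖ ≤ ‖z‖ :=
  (hE.isStarProjection_sub h).norm_apply_le z

/-- The first conjunct is carried through the induction: the partial sum lies in the range of `E (p
n)`, which is orthogonal to the next cell. -/
lemma norm_sum_sq (hE : IsSpectralFamily E) {n : ℕ} {p : ℕ → ℝ} (hp : ∀ i < n, p i ≤ p (i + 1))
    {u : ℕ → 𝒳} (hu : ∀ i < n, (E (p (i + 1)) - E (p i)) (u i) = u i) :
    E (p n) (∑ i ∈ Finset.range n, u i) = ∑ i ∈ Finset.range n, u i ∧
      ‖∑ i ∈ Finset.range n, u i‖ ^ 2 = ∑ i ∈ Finset.range n, ‖u i‖ ^ 2 := by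
  induction n with
  | zero => simp
  | succ n ih =>
    obtain ⟨h1, h2⟩ := ih (fun i hi => hp i (by omega)) (fun i hi => hu i (by omega))
    have hpn := hp n (by omega)
    have hun := hu n (by omega)
    have h3 : E (p n) (u n) = 0 := by
      rw [← hun, sub_apply, map_sub, hE.apply_apply hpn, hE.apply_apply le_rfl, sub_self]
    have h4 : E (p (n + 1)) (u n) = u n := by
      rw [sub_apply, h3, sub_zero] at hun
      exact hun
    rw [Finset.sum_range_succ, Finset.sum_range_succ]
    refine ⟨?_, ?_⟩
    · rw [map_add, h4, ← h1, hE.apply_apply' hpn]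
    · have h5 : inner ℂ (∑ i ∈ Finset.range n, u i) (u n) = 0 := by
        rw [← h1, (hE.projection _).inner_left, h3, inner_zero_right]
      have := norm_add_sq_eq_norm_sq_add_norm_sq_of_inner_eq_zero _ _ h5
      rw [← h2]
      nlinarith

/-- Pythagoras' theorem for vectors localized in the cells of a partition. -/
lemma norm_sum_le (hE : IsSpectralFamily E) {n : ℕ} {p : ℕ → ℝ} (hp : ∀ i < n, p i ≤ p (i + 1))
    {u : ℕ → 𝒳} (hu : ∀ i < n, (E (p (i + 1)) - E (p i)) (u i) = u i) {C : ℝ} (hC : 0 ≤ C) {z : 𝒳}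
    (hb : ∀ i < n, ‖u i‖ ≤ C * ‖(E (p (i + 1)) - E (p i)) z‖) :
    ‖∑ i ∈ Finset.range n, u i‖ ≤ C * ‖(E (p n) - E (p 0)) z‖ := by
  refine le_of_sq_le_sq ?_ (by positivity)
  have h1 := (hE.norm_sum_sq hp (u := fun i => (E (p (i + 1)) - E (p i)) z)
    fun i hi => (hE.isStarProjection_sub (hp i hi)).apply_apply z).2
  simp only [sub_apply] at h1
  rw [Finset.sum_range_sub (fun i => E (p i) z)] at h1
  rw [(hE.norm_sum_sq hp hu).2, mul_pow, sub_apply, h1, Finset.mul_sum]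
  refine Finset.sum_le_sum fun i hi => ?_
  rw [← mul_pow]
  have := hb i (Finset.mem_range.1 hi)
  rw [sub_apply] at this
  gcongr

lemma tendsto_sub (hE : IsSpectralFamily E) (z : 𝒳) :
    Tendsto (fun q : ℝ × ℝ => (E q.2 - E q.1) z) (Filter.atBot ×ˢ Filter.atTop) (𝓝 z) := by
  have h := ((hE.atTop z).comp tendsto_snd).sub ((hE.atBot z).comp
    (tendsto_fst (g := (Filter.atTop : Filter ℝ))))
  rwa [sub_zero] at h

end IsSpectralFamily

lemma eventually_fst_le_snd (p q : ℝ) :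
    ∀ᶠ x : ℝ × ℝ in atBot ×ˢ atTop, x.1 ≤ p ∧ q ≤ x.2 :=
  (eventually_le_atBot p).prod_mk (eventually_ge_atTop q)

namespace Localizes

/-- On each cell the preimage differs from the tagged term by at most the mesh times the norm of the
cell component of `z`; by Pythagoras the total error is at most the mesh times `‖z‖`. -/
lemma hasRSIntegral (h : Localizes E K) (hE : IsSpectralFamily E) (hinj : Function.Injective K)
    {a b : ℝ} {z V : 𝒳} (hV : K V = (E b - E a) z) :
    HasRSIntegral (fun ω => (ω : ℂ)) (fun ω => E ω z) a b V := by
  intro ε hε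
  have hη : 0 < ε / (‖z‖ + 1) := by positivity
  refine ⟨ε / (‖z‖ + 1), hη, fun n p ξ h0 hn hp => ?_⟩
  have hmono : ∀ i < n, p i ≤ p (i + 1) := fun i hi => (hp i hi).1.1.trans (hp i hi).1.2
  have hex : ∀ i, ∃ v, i < n → K v = (E (p (i + 1)) - E (p i)) z ∧
      ‖v - (ξ i : ℂ) • (E (p (i + 1)) - E (p i)) z‖ ≤
        (p (i + 1) - p i) * ‖(E (p (i + 1)) - E (p i)) z‖ := by
    intro i
    by_cases hi : i < n
    · obtain ⟨v, hv⟩ := h.exists_preimage (hp i hi).1.1 (hp i hi).1.2 z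
      exact ⟨v, fun _ => hv⟩
    · exact ⟨0, fun h => absurd h hi⟩
  choose v hv using hex
  have hsum : ∑ i ∈ Finset.range n, v i = V := by
    apply hinj
    rw [map_sum, hV, Finset.sum_congr rfl fun i hi => (hv i (Finset.mem_range.1 hi)).1]
    simp only [sub_apply]
    rw [Finset.sum_range_sub (fun i => E (p i) z), h0, hn]
  rw [← hsum, ← Finset.sum_sub_distrib]
  have hle := hE.norm_sum_le hmono (C := ε / (‖z‖ + 1)) (z := z)
    (u := fun i => (ξ i : ℂ) • (E (p (i + 1)) z - E (p i) z) - v i) ?_ hη.le ?_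
  · have hab := le_of_forall_le_succ hmono
    refine hle.trans_lt (lt_of_le_of_lt
      (mul_le_mul_of_nonneg_left (hE.norm_sub_apply_le hab z) hη.le) ?_)
    rw [div_mul_eq_mul_div, div_lt_iff₀ (by positivity)]
    nlinarith [norm_nonneg z]
  · intro i hi
    have hP := hE.isStarProjection_sub (hmono i hi)
    rw [map_sub, map_smul, ← sub_apply, hP.apply_apply]
    congr 1
    apply hinj
    rw [h.commute_sub, (hv i hi).1, hP.apply_apply]
  · intro i hi
    rw [← sub_apply, norm_sub_rev]
    refine (hv i hi).2.trans ?_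
    gcongr
    exact (hp i hi).2.le

lemma hasImproperRSIntegral_iff (h : Localizes E K) (hE : IsSpectralFamily E)
    (hinj : Function.Injective K) (z w : 𝒳) :
    K w = z ↔ HasImproperRSIntegral (fun ω => (ω : ℂ)) (fun ω => E ω z) w := by
  constructor
  · rintro rfl
    exact ⟨fun a b => (E b - E a) w,
      fun a b _ => h.hasRSIntegral hE hinj (h.commute_sub a b w), hE.tendsto_sub w⟩
  · rintro ⟨G, hG, hlim⟩
    refine tendsto_nhds_unique (((K.continuous.tendsto w).comp hlim).congr' ?_) (hE.tendsto_sub z)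
    filter_upwards [eventually_fst_le_snd 0 0] with x hx
    have hx' := hx.1.trans hx.2
    obtain ⟨V, hV, -⟩ := h.exists_preimage le_rfl hx' z
    have := (hG x.1 x.2 hx').unique (h.hasRSIntegral hE hinj hV) hx'
    change K (G x.1 x.2) = _
    rw [this, hV]

end Localizes

namespace IsSpectralFamily

lemma sub_apply_of_le_left (hE : IsSpectralFamily E) {s t p q : ℝ} (hst : s ≤ t) (htp : t ≤ p)
    (hpq : p ≤ q) (z : 𝒳) : (E t - E s) ((E q - E p) z) = 0 := by
  have : ∀ ω ≤ p, E ω ((E q - E p) z) = 0 := fun ω hω => by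
    rw [sub_apply, map_sub, hE.apply_apply (hω.trans hpq), hE.apply_apply hω, sub_self]
  rw [sub_apply, this t htp, this s (hst.trans htp), sub_self]

lemma apply_sub_of_le (hE : IsSpectralFamily E) {p q ω : ℝ} (hpq : p ≤ q) (hω : q ≤ ω) (z : 𝒳) :
    E ω ((E q - E p) z) = (E q - E p) z := by
  rw [sub_apply, map_sub, hE.apply_apply' hω, hE.apply_apply' (hpq.trans hω)]

lemma sub_apply_of_le_right (hE : IsSpectralFamily E) {s t p q : ℝ} (hst : s ≤ t) (hqs : q ≤ s)
    (hpq : p ≤ q) (z : 𝒳) : (E t - E s) ((E q - E p) z) = 0 := by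
  rw [sub_apply, hE.apply_sub_of_le hpq hqs, hE.apply_sub_of_le hpq (hqs.trans hst), sub_self]

lemma sub_apply_of_subset (hE : IsSpectralFamily E) {a b p q : ℝ} (hap : a ≤ p) (hpq : p ≤ q)
    (hqb : q ≤ b) (z : 𝒳) : (E b - E a) ((E q - E p) z) = (E q - E p) z := by
  rw [sub_apply, hE.apply_sub_of_le hpq hqb]
  have : E a ((E q - E p) z) = 0 := by
    rw [sub_apply, map_sub, hE.apply_apply (hap.trans hpq), hE.apply_apply hap, sub_self]
  rw [this, sub_zero]

/-- Only cells meeting `(p, q)` contribute to a sum. Their left endpoints are within `q - p` plus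
the mesh of `c`. -/
lemma norm_rsIntegral_sub_le (hE : IsSpectralFamily E) {a b p c q : ℝ} (hap : a ≤ p) (hpc : p ≤ c)
    (hcq : c ≤ q) (hqb : q ≤ b) {z I : 𝒳}
    (hI : HasRSIntegral (fun ω => (ω : ℂ)) (fun ω => E ω ((E q - E p) z)) a b I) :
    ‖I - (c : ℂ) • (E q - E p) z‖ ≤ (q - p) * ‖(E q - E p) z‖ := by
  have hpq := hpc.trans hcq
  have hab := hap.trans (hpq.trans hqb)
  have hx : (E b - E a) ((E q - E p) z) = (E q - E p) z := hE.sub_apply_of_subset hap hpq hqb z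
  have hleft : ∀ {s t : ℝ}, s ≤ t → t ≤ p → (E t - E s) ((E q - E p) z) = 0 :=
    fun hst htp => hE.sub_apply_of_le_left hst htp hpq z
  have hright : ∀ {s t : ℝ}, s ≤ t → q ≤ s → (E t - E s) ((E q - E p) z) = 0 :=
    fun hst hqs => hE.sub_apply_of_le_right hst hqs hpq z
  generalize (E q - E p) z = x at *
  refine le_of_forall_pos_le_add fun ε hε => ?_
  have hη : 0 < ε / 2 / (‖x‖ + 1) := by positivity
  obtain ⟨n, t, h0, hn, ht, hsum⟩ := hI.exists_sum hab (half_pos hε) hη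
  have hle := hE.norm_sum_le (fun i hi => (ht i hi).1) (C := q - p + ε / 2 / (‖x‖ + 1)) (z := x)
    (u := fun i => ((t i : ℂ) - c) • (E (t (i + 1)) x - E (t i) x)) ?_
    (by linarith) ?_
  · have h1 : ∑ i ∈ Finset.range n, ((t i : ℂ) - c) • (E (t (i + 1)) x - E (t i) x) =
        (∑ i ∈ Finset.range n, (t i : ℂ) • (E (t (i + 1)) x - E (t i) x)) - (c : ℂ) • x := by
      simp only [sub_smul, Finset.sum_sub_distrib]
      rw [← Finset.smul_sum, Finset.sum_range_sub (fun i => E (t i) x), h0, hn, ← sub_apply, hx]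
    rw [h1, h0, hn, hx] at hle
    have h2 : ε / 2 / (‖x‖ + 1) * ‖x‖ ≤ ε / 2 := by
      rw [div_mul_eq_mul_div, div_le_iff₀ (by positivity)]
      nlinarith
    rw [norm_sub_rev] at hsum
    have := norm_sub_le_norm_sub_add_norm_sub I
      (∑ i ∈ Finset.range n, (t i : ℂ) • (E (t (i + 1)) x - E (t i) x)) ((c : ℂ) • x)
    nlinarith
  · intro i hi
    rw [map_smul, ← sub_apply, (hE.isStarProjection_sub (ht i hi).1).apply_apply]
  · intro i hi
    rw [← sub_apply]
    rcases le_or_gt (t (i + 1)) p with h1 | h1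
    · rw [hleft (ht i hi).1 h1]
      simp
    rcases le_or_gt q (t i) with h2 | h2
    · rw [hright (ht i hi).1 h2]
      simp
    rw [norm_smul]
    gcongr
    rw [← Complex.ofReal_sub, Complex.norm_real, Real.norm_eq_abs, abs_le]
    have := (ht i hi).2
    constructor <;> linarith

/-- The bounded operator `E ω` passes under the integral and commutes with the family. -/
lemma commute_of_hasImproperRSIntegral (hE : IsSpectralFamily E)
    (hres : ∀ z w, K w = z ↔ HasImproperRSIntegral (fun ω => (ω : ℂ)) (fun ω => E ω z) w)
    (ω : ℝ) (z : 𝒳) : K (E ω z) = E ω (K z) := by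
  rw [hres]
  have := ((hres (K z) z).1 rfl).map (E ω)
  simpa only [hE.comm ω] using this

/-- For `z = K w` the preimage is `(E q - E p) w`, and its bound comes from the integral. The bound
makes these preimages Cauchy when `K w` converges, so density of the range of `K` gives all `z`. -/
lemma localizes_of_hasImproperRSIntegral (hE : IsSpectralFamily E) (hK : DenseRange K)
    (hres : ∀ z w, K w = z ↔ HasImproperRSIntegral (fun ω => (ω : ℂ)) (fun ω => E ω z) w) :
    Localizes E K where
  commute := hE.commute_of_hasImproperRSIntegral hres
  exists_preimage {p c q} hpc hcq z := by
    have hpq := hpc.trans hcq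
    have hcomm : ∀ w, K ((E q - E p) w) = (E q - E p) (K w) := fun w => by
      rw [sub_apply, sub_apply, map_sub, hE.commute_of_hasImproperRSIntegral hres,
        hE.commute_of_hasImproperRSIntegral hres]
    have hbound : ∀ w, ‖(E q - E p) w - (c : ℂ) • (E q - E p) (K w)‖ ≤
        (q - p) * ‖(E q - E p) (K w)‖ := by
      intro w
      obtain ⟨G, hG, hlim⟩ := (hres _ _).1 (hcomm w)
      refine le_of_tendsto ((hlim.sub_const _).norm) ?_
      filter_upwards [eventually_fst_le_snd p q] with x hx
      exact hE.norm_rsIntegral_sub_le hx.1 hpc hcq hx.2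
        (hG x.1 x.2 (hx.1.trans (hpq.trans hx.2)))
    obtain ⟨s, hs, hlim⟩ := mem_closure_iff_seq_limit.1 (hK z)
    choose w hw using hs
    have hlim' : Tendsto (fun n => K (w n)) Filter.atTop (𝓝 z) := by simpa only [hw] using hlim
    have hC : ∀ w, ‖(E q - E p) w‖ ≤ (|c| + (q - p)) * ‖K w‖ := by
      intro w
      have h1 := hbound w
      have h2 := hE.norm_sub_apply_le hpq (K w)
      have h3 := norm_sub_norm_le ((E q - E p) w) ((c : ℂ) • (E q - E p) (K w))
      rw [norm_smul, Complex.norm_real, Real.norm_eq_abs] at h3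
      have h4 : (|c| + (q - p)) * ‖(E q - E p) (K w)‖ ≤ (|c| + (q - p)) * ‖K w‖ := by
        have := abs_nonneg c
        apply mul_le_mul_of_nonneg_left h2
        linarith
      linarith
    have hcauchy : CauchySeq fun n => (E q - E p) (w n) := by
      rw [cauchySeq_iff_tendsto_dist_atTop_0]
      have h1 := cauchySeq_iff_tendsto_dist_atTop_0.1 hlim'.cauchySeq
      refine squeeze_zero (fun _ => dist_nonneg) (g := fun x : ℕ × ℕ =>
        (|c| + (q - p)) * dist (K (w x.1)) (K (w x.2))) (fun x => ?_) ?_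
      · rw [dist_eq_norm, dist_eq_norm, ← map_sub, ← map_sub]
        exact hC _
      · simpa using h1.const_mul (|c| + (q - p))
    obtain ⟨V, hV⟩ := cauchySeq_tendsto_of_complete hcauchy
    have hlim'' : Tendsto (fun n => (E q - E p) (K (w n))) Filter.atTop (𝓝 ((E q - E p) z)) :=
      ((E q - E p).continuous.tendsto z).comp hlim'
    refine ⟨V, tendsto_nhds_unique ((K.continuous.tendsto V).comp hV) ?_, ?_⟩
    · refine hlim''.congr fun n => ?_
      exact (hcomm (w n)).symm
    · exact le_of_tendsto_of_tendsto' (hV.sub (hlim''.const_smul _)).norm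
        (hlim''.norm.const_mul _) fun n => hbound (w n)

end IsSpectralFamily

end StieltjesIntegrals

/-! ### The Schrödinger equation for `K⁻¹` in integrated form. -/

section Dynamics

variable {𝒳 : Type*} [NormedAddCommGroup 𝒳] [InnerProductSpace ℂ 𝒳]

lemma _root_.HasDerivAt.continuousLinearMap_apply {y : ℝ → 𝒳} {y' : 𝒳} {t : ℝ}
    (h : HasDerivAt y y' t) (L : 𝒳 →L[ℂ] 𝒳) : HasDerivAt (fun t => L (y t)) (L y') t :=
  (L.restrictScalars ℝ).hasFDerivAt.comp_hasDerivAt t h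

variable {K : 𝒳 →L[ℂ] 𝒳}

/-- `Y` is continuous and solves the equation `i Y' = H Y` with `H = K⁻¹`, integrated and
multiplied by `K`. -/
structure IsIntegralSolution (K : 𝒳 →L[ℂ] 𝒳) (Y : ℝ → 𝒳) : Prop where
  continuous : Continuous Y
  integral_eq : ∀ t : ℝ, ∫ s in (0 : ℝ)..t, Y s = Complex.I • K (Y t - Y 0)

lemma IsIntegralSolution.of_norm_sub_le {y : ℕ → ℝ → 𝒳} {Y : ℝ → 𝒳}
    (hy : ∀ n, IsIntegralSolution K (y n)) {r : ℕ → ℝ} (hr : Tendsto r atTop (𝓝 0))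
    (hle : ∀ n t, ‖Y t - y n t‖ ≤ r n) : IsIntegralSolution K Y := by
  have hunif : TendstoUniformly y Y atTop := by
    rw [Metric.tendstoUniformly_iff]
    intro ε hε
    filter_upwards [hr.eventually (gt_mem_nhds hε)] with n hn t
    rw [dist_eq_norm]
    exact (hle n t).trans_lt hn
  have hcont : Continuous Y :=
    hunif.continuous (Eventually.of_forall fun n => (hy n).continuous).frequently
  refine ⟨hcont, fun t => ?_⟩
  have h1 : Tendsto (fun n => ∫ s in (0 : ℝ)..t, y n s) atTop (𝓝 (∫ s in (0 : ℝ)..t, Y s)) := by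
    rw [tendsto_iff_norm_sub_tendsto_zero]
    refine squeeze_zero (fun _ => norm_nonneg _) (g := fun n => r n * |t - 0|) (fun n => ?_)
      (by simpa using hr.mul_const |t - 0|)
    rw [← intervalIntegral.integral_sub ((hy n).continuous.intervalIntegrable 0 t)
      (hcont.intervalIntegrable 0 t)]
    refine intervalIntegral.norm_integral_le_of_norm_le_const (f := fun s => y n s - Y s)
      fun s _ => ?_
    rw [norm_sub_rev]
    exact hle n s
  refine tendsto_nhds_unique h1 ?_
  have h2 := ((K.continuous.tendsto _).comp
    ((hunif.tendsto_at t).sub (hunif.tendsto_at 0))).const_smul Complex.I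
  exact h2.congr fun n => ((hy n).integral_eq t).symm

variable [CompleteSpace 𝒳] {E : ℝ → 𝒳 →L[ℂ] 𝒳}

/-- `T` is the inverse of `K` restricted to the range of the projection `P`. -/
structure IsTruncatedInverse (K P T : 𝒳 →L[ℂ] 𝒳) : Prop where
  selfAdjoint : IsSelfAdjoint T
  map_apply : ∀ z, K (T z) = P z
  apply_map : ∀ z, T (K z) = P z
  proj_apply : ∀ z, P (T z) = T z
  apply_proj : ∀ z, T (P z) = T z

/-- Injectivity of `K` makes the chosen preimages linear in `z`; localization with `c = p` makes
them bounded. -/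
lemma Localizes.exists_isTruncatedInverse (h : Localizes E K) (hE : IsSpectralFamily E)
    (hK : IsSelfAdjoint K) (hinj : Function.Injective K) {p q : ℝ} (hpq : p ≤ q) :
    ∃ T, IsTruncatedInverse K (E q - E p) T := by
  choose V hV hb using h.exists_preimage le_rfl hpq
  have hP := hE.isStarProjection_sub hpq
  let T₀ : 𝒳 →ₗ[ℂ] 𝒳 :=
    { toFun := V
      map_add' := fun x y => hinj (by rw [map_add, hV, hV, hV, map_add])
      map_smul' := fun c x => hinj (by rw [RingHom.id_apply, map_smul, hV, hV, map_smul]) }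
  let T : 𝒳 →L[ℂ] 𝒳 := T₀.mkContinuous (|p| + (q - p)) fun z => by
    change ‖V z‖ ≤ _
    have h1 := hb z
    have h2 := hE.norm_sub_apply_le hpq z
    have h3 := norm_sub_norm_le (V z) ((p : ℂ) • (E q - E p) z)
    rw [norm_smul, Complex.norm_real, Real.norm_eq_abs] at h3
    have h4 : (|p| + (q - p)) * ‖(E q - E p) z‖ ≤ (|p| + (q - p)) * ‖z‖ := by
      have := abs_nonneg p
      apply mul_le_mul_of_nonneg_left h2
      linarith
    linarith
  have hKT : ∀ z, K (T z) = (E q - E p) z := hV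
  have hPT : ∀ z, (E q - E p) (T z) = T z := fun z => hinj (by
    rw [h.commute_sub, hKT, hP.apply_apply])
  have hTK : ∀ z, T (K z) = (E q - E p) z := fun z => hinj (by
    rw [hKT, h.commute_sub])
  refine ⟨T, ContinuousLinearMap.isSelfAdjoint_iff_isSymmetric.2 fun x y => ?_, hKT, hTK, hPT,
    fun z => hinj (by rw [hKT, hKT, hP.apply_apply])⟩
  change inner ℂ (T x) y = inner ℂ x (T y)
  rw [← hPT x, hP.inner_left, ← hKT y, ← hK.inner_map_left, hKT, hP.inner_left, hPT]

lemma Localizes.norm_sub_le (h : Localizes E K) (hinj : Function.Injective K) {p c q : ℝ}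
    (hpc : p ≤ c) (hcq : c ≤ q) {T : 𝒳 →L[ℂ] 𝒳} (hT : IsTruncatedInverse K (E q - E p) T) (z : 𝒳) :
    ‖T z - (c : ℂ) • (E q - E p) z‖ ≤ (q - p) * ‖(E q - E p) z‖ := by
  obtain ⟨V, hV, hb⟩ := h.exists_preimage hpc hcq z
  rwa [hinj ((hT.map_apply z).trans hV.symm)]

section Schrodinger

variable {T : 𝒳 →L[ℂ] 𝒳} {w : ℝ → 𝒳}

lemma norm_eq_of_hasDerivAt (hT : IsSelfAdjoint T)
    (hw : ∀ t, HasDerivAt w (-(Complex.I • T (w t))) t) (t : ℝ) : ‖w t‖ = ‖w 0‖ := by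
  have h1 : ∀ t, HasDerivAt (fun t => inner ℂ (w t) (w t)) 0 t := fun t => by
    have h0 : inner ℂ (w t) (-(Complex.I • T (w t))) +
        inner ℂ (-(Complex.I • T (w t))) (w t) = 0 := by
      rw [inner_neg_right, inner_neg_left, inner_smul_left, inner_smul_right, hT.inner_map_left,
        Complex.conj_I]
      ring
    have := (hw t).inner ℂ (hw t)
    rw [h0] at this
    exact this
  have h2 := is_const_of_deriv_eq_zero (fun t => (h1 t).differentiableAt)
    (fun t => (h1 t).deriv) t 0
  have h3 := congrArg Complex.re h2
  simp only [re_inner_self] at h3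
  exact (sq_eq_sq₀ (norm_nonneg _) (norm_nonneg _)).1 h3

lemma norm_exp_neg_mul (c t : ℝ) : ‖Complex.exp (-(Complex.I * (c : ℂ) * (t : ℂ)))‖ = 1 := by
  rw [show -(Complex.I * (c : ℂ) * (t : ℂ)) = ((-(c * t) : ℝ) : ℂ) * Complex.I by push_cast; ring]
  exact Complex.norm_exp_ofReal_mul_I _

/-- The derivative of `e^{ict} w` has norm `‖(T - c) w‖`, which is at most `C ‖w 0‖` because the
flow preserves norms. -/
lemma norm_exp_smul_sub_le (hT : IsSelfAdjoint T)
    (hw : ∀ t, HasDerivAt w (-(Complex.I • T (w t))) t) {c C : ℝ}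
    (hC : ∀ t, ‖T (w t) - (c : ℂ) • w t‖ ≤ C * ‖w t‖) (t : ℝ) :
    ‖Complex.exp (-(Complex.I * (c : ℂ) * (t : ℂ))) • w 0 - w t‖ ≤ C * |t| * ‖w 0‖ := by
  have he : ∀ s : ℝ, HasDerivAt (fun s : ℝ => Complex.exp (Complex.I * (c : ℂ) * (s : ℂ)))
      (Complex.exp (Complex.I * (c : ℂ) * (s : ℂ)) * (Complex.I * (c : ℂ) * 1)) s := fun s =>
    ((Complex.ofRealCLM.hasDerivAt (x := s)).const_mul (Complex.I * (c : ℂ))).cexp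
  have hn : ∀ s : ℝ, ‖Complex.exp (Complex.I * (c : ℂ) * (s : ℂ))‖ = 1 := fun s => by
    have := norm_exp_neg_mul (-c) s
    rwa [Complex.ofReal_neg, mul_neg, neg_mul, neg_neg] at this
  have hd := fun s => (he s).smul (hw s)
  have hb := Convex.norm_image_sub_le_of_norm_hasDerivWithin_le (s := univ) (x := 0) (y := t)
    (C := C * ‖w 0‖) (fun s _ => (hd s).hasDerivWithinAt) (fun s _ => ?_) convex_univ
    (mem_univ _) (mem_univ _)
  · have h1 : Complex.exp (-(Complex.I * (c : ℂ) * (t : ℂ))) • w 0 - w t =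
        -(Complex.exp (-(Complex.I * (c : ℂ) * (t : ℂ))) •
          (Complex.exp (Complex.I * (c : ℂ) * (t : ℂ)) • w t -
            Complex.exp (Complex.I * (c : ℂ) * ((0 : ℝ) : ℂ)) • w 0)) := by
      rw [smul_sub, smul_smul, ← Complex.exp_add, neg_add_cancel, Complex.exp_zero]
      simp
    rw [h1, norm_neg, norm_smul, norm_exp_neg_mul, one_mul]
    refine hb.trans (le_of_eq ?_)
    rw [sub_zero, Real.norm_eq_abs]
    ring
  · have h1 : Complex.exp (Complex.I * (c : ℂ) * (s : ℂ)) • -(Complex.I • T (w s)) +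
        (Complex.exp (Complex.I * (c : ℂ) * (s : ℂ)) * (Complex.I * (c : ℂ) * 1)) • w s =
        Complex.exp (Complex.I * (c : ℂ) * (s : ℂ)) •
          (-(Complex.I • (T (w s) - (c : ℂ) • w s))) := by
      module
    rw [h1, norm_smul, hn, one_mul, norm_neg, norm_smul, Complex.norm_I, one_mul,
      ← norm_eq_of_hasDerivAt hT hw s]
    exact hC s

end Schrodinger

namespace IsIntegralSolution

variable {Y : ℝ → 𝒳}

/-- Applying `T` to the integral equation and using `T K = P` gives `P (Y t) = P (Y 0) - i ∫ T Y`.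
-/
lemma hasDerivAt (hY : IsIntegralSolution K Y) {P T : 𝒳 →L[ℂ] 𝒳} (hT : IsTruncatedInverse K P T)
    (t : ℝ) : HasDerivAt (fun t => P (Y t)) (-(Complex.I • T (P (Y t)))) t := by
  have hcont : Continuous fun s => T (Y s) := T.continuous.comp hY.continuous
  have h1 : ∀ t, P (Y t) = P (Y 0) + -(Complex.I • ∫ s in (0 : ℝ)..t, T (Y s)) := by
    intro t
    rw [T.intervalIntegral_comp_comm (hY.continuous.intervalIntegrable 0 t), hY.integral_eq,
      map_smul, hT.apply_map, smul_smul, Complex.I_mul_I, map_sub]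
    module
  have h2 := (hcont.integral_hasStrictDerivAt 0 t).hasDerivAt
  rw [hT.apply_proj]
  refine HasDerivAt.congr_of_eventuallyEq
    (((h2.const_smul Complex.I).neg).const_add (P (Y 0))) (Eventually.of_forall h1)

/-- On each cell the exact evolution replaces the exponential at the tag, with relative error at
most the mesh times `|t|`; the errors are orthogonal. -/
lemma hasRSIntegral (hY : IsIntegralSolution K Y) (h : Localizes E K) (hE : IsSpectralFamily E)
    (hK : IsSelfAdjoint K) (hinj : Function.Injective K) (t a b : ℝ) :
    HasRSIntegral (fun ω : ℝ => Complex.exp (-(Complex.I * (ω : ℂ) * (t : ℂ))))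
      (fun ω => E ω (Y 0)) a b ((E b - E a) (Y t)) := by
  intro ε hε
  have hη : 0 < ε / (|t| * ‖Y 0‖ + 1) := by positivity
  refine ⟨_, hη, fun n p ξ h0 hn hp => ?_⟩
  have hmono : ∀ i < n, p i ≤ p (i + 1) := fun i hi => (hp i hi).1.1.trans (hp i hi).1.2
  have hsum : (E b - E a) (Y t) =
      ∑ i ∈ Finset.range n, (E (p (i + 1)) (Y t) - E (p i) (Y t)) := by
    rw [Finset.sum_range_sub (fun i => E (p i) (Y t)), h0, hn, sub_apply]
  rw [hsum, ← Finset.sum_sub_distrib]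
  have hle := hE.norm_sum_le hmono (C := ε / (|t| * ‖Y 0‖ + 1) * |t|) (z := Y 0)
    (u := fun i => Complex.exp (-(Complex.I * (ξ i : ℂ) * (t : ℂ))) •
      (E (p (i + 1)) (Y 0) - E (p i) (Y 0)) - (E (p (i + 1)) (Y t) - E (p i) (Y t))) ?_
      (by positivity) ?_
  · have hab := le_of_forall_le_succ hmono
    refine hle.trans_lt (lt_of_le_of_lt
      (mul_le_mul_of_nonneg_left (hE.norm_sub_apply_le hab (Y 0)) (by positivity)) ?_)
    rw [mul_assoc, div_mul_eq_mul_div, div_lt_iff₀ (by positivity)]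
    nlinarith [norm_nonneg (Y 0), abs_nonneg t]
  · intro i hi
    have hP := hE.isStarProjection_sub (hmono i hi)
    rw [map_sub, map_smul, ← sub_apply, ← sub_apply, hP.apply_apply, hP.apply_apply]
  · intro i hi
    obtain ⟨T, hT⟩ := h.exists_isTruncatedInverse hE hK hinj (hmono i hi)
    have hP := hE.isStarProjection_sub (hmono i hi)
    rw [← sub_apply, ← sub_apply]
    refine (norm_exp_smul_sub_le hT.selfAdjoint (hY.hasDerivAt hT) (c := ξ i)
      (C := p (i + 1) - p i) (fun s => ?_) t).trans ?_
    · have := h.norm_sub_le hinj (hp i hi).1.1 (hp i hi).1.2 hT ((E (p (i + 1)) - E (p i)) (Y s))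
      rwa [hP.apply_apply] at this
    · have := (hp i hi).2.le
      gcongr

lemma hasImproperRSIntegral (hY : IsIntegralSolution K Y) (h : Localizes E K)
    (hE : IsSpectralFamily E) (hK : IsSelfAdjoint K) (hinj : Function.Injective K) (t : ℝ) :
    HasImproperRSIntegral (fun ω : ℝ => Complex.exp (-(Complex.I * (ω : ℂ) * (t : ℂ))))
      (fun ω => E ω (Y 0)) (Y t) :=
  ⟨fun a b => (E b - E a) (Y t), fun a b _ => hY.hasRSIntegral h hE hK hinj t a b,
    hE.tendsto_sub (Y t)⟩

end IsIntegralSolution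

lemma IsTruncatedInverse.exists_solution {P T : 𝒳 →L[ℂ] 𝒳} (hT : IsTruncatedInverse K P T)
    (hP : IsStarProjection P) (Y₀ : 𝒳) :
    ∃ y : ℝ → 𝒳, (∀ t, HasDerivAt y (-(Complex.I • T (y t))) t) ∧ y 0 = P Y₀ ∧
      ∀ t, P (y t) = y t := by
  have hd : ∀ t : ℝ, HasDerivAt (fun t : ℝ => NormedSpace.exp (t • -(Complex.I • T)) (P Y₀))
      (-(Complex.I • T (NormedSpace.exp (t • -(Complex.I • T)) (P Y₀)))) t := by
    intro t
    have h1 := hasDerivAt_exp_smul_const' (𝕂 := ℝ) (-(Complex.I • T)) t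
    exact ((ContinuousLinearMap.apply ℂ 𝒳 (P Y₀)).restrictScalars ℝ).hasFDerivAt.comp_hasDerivAt t h1
  have h0 : NormedSpace.exp ((0 : ℝ) • -(Complex.I • T)) (P Y₀) = P Y₀ := by
    rw [zero_smul, NormedSpace.exp_zero]
    rfl
  refine ⟨_, hd, h0, fun t => ?_⟩
  -- The component in the range of `1 - P` is constant because `T` maps into the range of `P`, and
  -- it is zero at time `0`.
  have h2 : ∀ t : ℝ, HasDerivAt
      (fun t : ℝ => (1 - P) (NormedSpace.exp (t • -(Complex.I • T)) (P Y₀))) 0 t := by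
    intro t
    have := (hd t).continuousLinearMap_apply (1 - P)
    rwa [map_neg, map_smul, sub_apply (1 : 𝒳 →L[ℂ] 𝒳) P, one_apply_eq_self, hT.proj_apply,
      sub_self, smul_zero, neg_zero] at this
  have h3 := is_const_of_deriv_eq_zero (fun t => (h2 t).differentiableAt)
    (fun t => (h2 t).deriv) t 0
  simp only [h0] at h3
  rw [sub_apply, sub_apply, one_apply_eq_self, one_apply_eq_self, hP.apply_apply, sub_self] at h3
  exact (sub_eq_zero.1 h3).symm

lemma IsTruncatedInverse.integral_eq {P T : 𝒳 →L[ℂ] 𝒳} (hT : IsTruncatedInverse K P T) {y : ℝ → 𝒳}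
    (hy : ∀ t, HasDerivAt y (-(Complex.I • T (y t))) t) (hP : ∀ t, P (y t) = y t) (t : ℝ) :
    ∫ s in (0 : ℝ)..t, y s = Complex.I • K (y t - y 0) := by
  have hcont : Continuous y := continuous_iff_continuousAt.2 fun t => (hy t).continuousAt
  have hd : ∀ t, HasDerivAt (fun t => Complex.I • K (y t)) (y t) t := fun t => by
    have := ((hy t).continuousLinearMap_apply K).const_smul Complex.I
    rwa [map_neg, map_smul, hT.map_apply, hP, smul_neg, smul_smul, Complex.I_mul_I, neg_smul,
      one_smul, neg_neg] at this
  rw [intervalIntegral.integral_eq_sub_of_hasDerivAt (fun s _ => hd s)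
    (hcont.intervalIntegrable 0 t), map_sub, smul_sub]

/-- On the smaller range the two generators agree, so both functions solve the equation of `T'` and
their difference keeps its norm. -/
lemma IsTruncatedInverse.norm_sub_eq (hinj : Function.Injective K) {P P' T T' : 𝒳 →L[ℂ] 𝒳}
    (hT : IsTruncatedInverse K P T) (hT' : IsTruncatedInverse K P' T')
    (hPP' : ∀ z, P' (P z) = P z) {y y' : ℝ → 𝒳}
    (hy : ∀ t, HasDerivAt y (-(Complex.I • T (y t))) t) (hP : ∀ t, P (y t) = y t)
    (hy' : ∀ t, HasDerivAt y' (-(Complex.I • T' (y' t))) t) (t : ℝ) :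
    ‖y' t - y t‖ = ‖y' 0 - y 0‖ := by
  have hTT : ∀ s, T' (y s) = T (y s) := fun s => hinj (by
    rw [hT'.map_apply, hT.map_apply, ← hP s, hPP', hP, hP])
  refine norm_eq_of_hasDerivAt (w := fun t => y' t - y t) hT'.selfAdjoint (fun t => ?_) t
  have := (hy' t).sub (hy t)
  rwa [← hTT, neg_sub_neg, ← smul_sub, ← map_sub, ← neg_sub (y' t), map_neg, smul_neg] at this

/-- The solutions cut off to `[-n, n]` stay as close as their initial values, uniformly in time, so
their limit inherits the integral equation. -/
lemma Localizes.exists_isIntegralSolution (h : Localizes E K) (hE : IsSpectralFamily E)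
    (hK : IsSelfAdjoint K) (hinj : Function.Injective K) (Y₀ : 𝒳) :
    ∃ Y, IsIntegralSolution K Y ∧ Y 0 = Y₀ := by
  have hle : ∀ n : ℕ, -(n : ℝ) ≤ n := fun n => by
    have : (0 : ℝ) ≤ n := Nat.cast_nonneg n
    linarith
  obtain ⟨P, hPdef⟩ : ∃ P : ℕ → 𝒳 →L[ℂ] 𝒳, ∀ n : ℕ, P n = E n - E (-n) := ⟨_, fun _ => rfl⟩
  have hP : ∀ n, IsStarProjection (P n) := fun n => by
    rw [hPdef]
    exact hE.isStarProjection_sub (hle n)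
  have hPlim : Tendsto (fun n => P n Y₀) atTop (𝓝 Y₀) := by
    have h1 : Tendsto (fun n : ℕ => (n : ℝ)) atTop atTop := tendsto_natCast_atTop_atTop
    have h2 : Tendsto (fun n : ℕ => -(n : ℝ)) atTop atBot := tendsto_neg_atTop_atBot.comp h1
    have h3 : Tendsto (fun n : ℕ => ((-(n : ℝ), (n : ℝ)) : ℝ × ℝ)) atTop (atBot ×ˢ atTop) :=
      h2.prodMk h1
    refine ((hE.tendsto_sub Y₀).comp h3).congr fun n => ?_
    rw [hPdef]
    rfl
  have hPP : ∀ {n m : ℕ}, n ≤ m → ∀ z, P m (P n z) = P n z := fun {n m} hnm z => by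
    rw [hPdef, hPdef]
    exact hE.sub_apply_of_subset (neg_le_neg (Nat.cast_le.2 hnm)) (hle n) (Nat.cast_le.2 hnm) z
  have hex : ∀ n, ∃ T, IsTruncatedInverse K (P n) T := fun n => by
    rw [hPdef]
    exact h.exists_isTruncatedInverse hE hK hinj (hle n)
  choose T hT using hex
  choose y hy hy0 hPy using fun n => (hT n).exists_solution (hP n) Y₀
  have hdist : ∀ n m t, ‖y m t - y n t‖ = ‖P m Y₀ - P n Y₀‖ := by
    intro n m t
    rw [← hy0, ← hy0]
    rcases le_total n m with hnm | hnm
    · exact (hT n).norm_sub_eq hinj (hT m) (hPP hnm) (hy n) (hPy n) (hy m) t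
    · rw [norm_sub_rev, norm_sub_rev (y m 0)]
      exact (hT m).norm_sub_eq hinj (hT n) (hPP hnm) (hy m) (hPy m) (hy n) t
  have hcauchy : ∀ t, CauchySeq fun n => y n t := fun t => by
    have h1 := cauchySeq_iff_tendsto_dist_atTop_0.1 hPlim.cauchySeq
    refine cauchySeq_iff_tendsto_dist_atTop_0.2 (h1.congr fun x => ?_)
    rw [dist_eq_norm, dist_eq_norm, hdist]
  choose Y hY using fun t => cauchySeq_tendsto_of_complete (hcauchy t)
  have hrate : ∀ n t, ‖Y t - y n t‖ = ‖Y₀ - P n Y₀‖ := fun n t =>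
    tendsto_nhds_unique ((hY t).sub_const (y n t)).norm
      ((hPlim.sub_const (P n Y₀)).norm.congr fun m => (hdist n m t).symm)
  have hrate0 : Tendsto (fun n => ‖Y₀ - P n Y₀‖) atTop (𝓝 0) := by
    have := (hPlim.const_sub Y₀).norm
    rwa [sub_self, norm_zero] at this
  refine ⟨Y, IsIntegralSolution.of_norm_sub_le (fun n => ⟨?_, ?_⟩) hrate0
    fun n t => (hrate n t).le, tendsto_nhds_unique (hY 0) (by simpa only [hy0] using hPlim)⟩
  · exact continuous_iff_continuousAt.2 fun t => (hy n t).continuousAt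
  · exact (hT n).integral_eq (hy n) (hPy n)

end Dynamics

/-! ### From the Hamilton equation to the Schrödinger equation, and the main theorem. -/

section Hamilton

variable {𝒳 : Type*} [NormedAddCommGroup 𝒳] [InnerProductSpace ℂ 𝒳]
  {B Λ : 𝒳 →ₗ.[ℂ] 𝒳} {J R S K : 𝒳 →L[ℂ] 𝒳}

lemma apply_apply_of_comp_eq_neg_id (hJ2 : J ∘L J = -ContinuousLinearMap.id ℂ 𝒳) (x : 𝒳) :
    J (J x) = -x :=
  DFunLike.congr_fun hJ2 x

lemma I_smul_comp_I_smul (hJ2 : J ∘L J = -ContinuousLinearMap.id ℂ 𝒳) :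
    (Complex.I • J) ∘L (Complex.I • J) = ContinuousLinearMap.id ℂ 𝒳 := by
  ext x
  change Complex.I • J (Complex.I • J x) = x
  rw [map_smul, apply_apply_of_comp_eq_neg_id hJ2, smul_smul, Complex.I_mul_I, smul_neg, neg_smul,
    one_smul, neg_neg]

lemma HasInverse.schrodinger (hS : HasInverse Λ S)
    (hJ2 : J ∘L J = -ContinuousLinearMap.id ℂ 𝒳) :
    HasInverse (schrodinger J Λ) ((S ∘L (Complex.I • J)) ∘L S) :=
  hS.comp (hS.compPMap (I_smul_comp_I_smul hJ2) (I_smul_comp_I_smul hJ2))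

lemma HasInverse.generator (hR : HasInverse B R) (hJ2 : J ∘L J = -ContinuousLinearMap.id ℂ 𝒳) :
    HasInverse (generator J B) (R ∘L (-J)) := by
  refine hR.compPMap ?_ ?_
  · ext x
    change J (-J x) = x
    rw [map_neg, apply_apply_of_comp_eq_neg_id hJ2, neg_neg]
  · ext x
    change -J (J x) = x
    rw [apply_apply_of_comp_eq_neg_id hJ2, neg_neg]

lemma HasInverse.inverse_eq (hS : HasInverse Λ S) (x : Λ.domain) :
    ∃ h : Λ x ∈ Λ.inverse.domain, (x : 𝒳) = Λ.inverse ⟨Λ x, h⟩ := by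
  have hker : LinearMap.ker Λ.toFun = ⊥ := LinearMap.ker_eq_bot.2 hS.bijective.1
  refine ⟨?_, ?_⟩
  · rw [LinearPMap.inverse_domain]
    exact ⟨x, rfl⟩
  · exact (LinearPMap.inverse_apply_eq hker rfl).symm

lemma I_smul_comp_I_smul_comp (x : 𝒳) :
    Complex.I • ((S ∘L (Complex.I • J)) ∘L S) x = S (-J (S x)) := by
  change Complex.I • S (Complex.I • J (S x)) = _
  rw [map_smul, smul_smul, Complex.I_mul_I, neg_smul, one_smul, map_neg]

variable [CompleteSpace 𝒳]

lemma isSelfAdjoint_comp_I_smul_comp (hS : IsSelfAdjoint S)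
    (hJ : ContinuousLinearMap.adjoint J = -J) :
    IsSelfAdjoint ((S ∘L (Complex.I • J)) ∘L S) := by
  rw [ContinuousLinearMap.isSelfAdjoint_iff_isSymmetric]
  intro x y
  change inner ℂ (S (Complex.I • J (S x))) y = inner ℂ x (S (Complex.I • J (S y)))
  rw [hS.inner_map_left, inner_smul_left, ← ContinuousLinearMap.adjoint_inner_right, hJ,
    ← hS.inner_map_left, inner_smul_right, Complex.conj_I]
  simp

/-- Inverting `J B` turns the equation into `∫ X = -R J (X t - X 0)`. With `X = S Y` and `R = S²`,
one injective factor `S` cancels, and `-S J S = i K`. -/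
lemma isMildSolution_iff (hR : HasInverse B R) (hS : HasInverse Λ S) (hSR : S ∘L S = R)
    (hJ2 : J ∘L J = -ContinuousLinearMap.id ℂ 𝒳) (X : ℝ → Λ.domain) :
    IsMildSolution J B Λ X ↔
      IsIntegralSolution ((S ∘L (Complex.I • J)) ∘L S) (fun t => Λ (X t)) := by
  have hX : ∀ t, (X t : 𝒳) = S (Λ (X t)) := fun t => (hS.inverse_apply (X t)).symm
  have key : (Continuous fun t => Λ (X t)) → ∀ t,
      ((∃ h : (∫ s in (0 : ℝ)..t, (X s : 𝒳)) ∈ (generator J B).domain,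
        generator J B ⟨∫ s in (0 : ℝ)..t, (X s : 𝒳), h⟩ = (X t : 𝒳) - X 0) ↔
      ∫ s in (0 : ℝ)..t, Λ (X s) =
        Complex.I • ((S ∘L (Complex.I • J)) ∘L S) (Λ (X t) - Λ (X 0))) := by
    intro hc t
    have h1 : ∫ s in (0 : ℝ)..t, (X s : 𝒳) = S (∫ s in (0 : ℝ)..t, Λ (X s)) := by
      rw [← S.intervalIntegral_comp_comm (hc.intervalIntegrable 0 t)]
      simp only [hX]
    have h2 : (R ∘L (-J)) ((X t : 𝒳) - X 0) = S (S (-J (S (Λ (X t) - Λ (X 0))))) := by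
      rw [map_sub S, ← hX, ← hX, ← hSR]
      rfl
    rw [hR.generator hJ2, h1, I_smul_comp_I_smul_comp, h2, hS.injective.eq_iff]
    exact eq_comm
  constructor
  · rintro ⟨h1, h2⟩
    refine ⟨h1, fun t => (key h1 t).1 ?_⟩
    obtain ⟨h3, h4⟩ := h2 t
    exact ⟨h3, h4.symm⟩
  · rintro ⟨h1, h2⟩
    refine ⟨h1, fun t => ?_⟩
    obtain ⟨h3, h4⟩ := (key h1 t).2 (h2 t)
    exact ⟨h3, h4.symm⟩

end Hamilton

end ComplexHamilton

end

theorem proposition2p4 {𝒳 : Type*} [NormedAddCommGroup 𝒳] [InnerProductSpace ℂ 𝒳]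
    [CompleteSpace 𝒳]
    (B : 𝒳 →ₗ.[ℂ] 𝒳) (hB : IsSelfAdjoint B)
    (J : 𝒳 →L[ℂ] 𝒳) (hJ : ContinuousLinearMap.adjoint J = -J)
    (hJ2 : J ∘L J = -ContinuousLinearMap.id ℂ 𝒳)
    (δ : ℝ) (hδ : 0 < δ)
    (hP : ComplexHamilton.spectrum B ⊆ (fun r : ℝ => (r : ℂ)) '' Set.Ici δ) :
    (∃ Λ : 𝒳 →ₗ.[ℂ] 𝒳, ComplexHamilton.IsPositiveSqrt Λ B) ∧
    ∀ Λ : 𝒳 →ₗ.[ℂ] 𝒳, ComplexHamilton.IsPositiveSqrt Λ B →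
      Function.Bijective (fun x : Λ.domain => Λ x) ∧
      IsSelfAdjoint (ComplexHamilton.schrodinger J Λ) ∧
      (∃ E : ℝ → 𝒳 →L[ℂ] 𝒳,
        ComplexHamilton.IsSpectralResolution E (ComplexHamilton.schrodinger J Λ)) ∧
      (∀ X₀ : Λ.domain, ∃ X : ℝ → Λ.domain,
        ComplexHamilton.IsMildSolution J B Λ X ∧ X 0 = X₀) ∧
      ∀ E : ℝ → 𝒳 →L[ℂ] 𝒳,
        ComplexHamilton.IsSpectralResolution E (ComplexHamilton.schrodinger J Λ) →
        ∀ X : ℝ → Λ.domain, ComplexHamilton.IsMildSolution J B Λ X →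
        ∀ t : ℝ, ∃ (Z : 𝒳) (hZ : Z ∈ Λ.inverse.domain),
          ComplexHamilton.HasImproperRSIntegral
            (fun ω : ℝ => Complex.exp (-(Complex.I * (ω : ℂ) * (t : ℂ))))
            (fun ω : ℝ => E ω (Λ (X 0))) Z ∧
          (X t : 𝒳) = Λ.inverse ⟨Z, hZ⟩ := by
  have hres : ∀ z : ℂ, (∀ r : ℝ, δ ≤ r → (r : ℂ) ≠ z) → z ∈ ComplexHamilton.resolventSet B := by
    intro z hz
    by_contra hn
    obtain ⟨r, hr, e⟩ := hP hn
    exact hz r hr e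
  obtain ⟨R, hR⟩ := ComplexHamilton.HasInverse.exists_of_zero_mem_resolventSet
    (hres 0 fun r hr => by exact_mod_cast (hδ.trans_le hr).ne')
  have hRsa := hR.isSelfAdjoint_inverse hB
  have hRnonneg : 0 ≤ R := hR.nonneg_of_spectrum hRsa fun s hs =>
    hres s fun r hr => by exact_mod_cast (hs.trans (hδ.trans_le hr)).ne'
  refine ⟨hR.exists_isPositiveSqrt hRnonneg, fun Λ hΛ => ?_⟩
  obtain ⟨S, hS, hSsa, hSR⟩ := hR.exists_of_isPositiveSqrt hΛ
  have hH := hS.schrodinger hJ2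
  have hKsa := ComplexHamilton.isSelfAdjoint_comp_I_smul_comp hSsa hJ
  have hinj := hH.injective
  have hmild := ComplexHamilton.isMildSolution_iff hR hS hSR hJ2
  set K := (S ∘L (Complex.I • J)) ∘L S
  have hE := ComplexHamilton.isSpectralFamily_spectralProj hKsa hinj
  have hloc := ComplexHamilton.localizes_spectralProj hKsa hinj
  refine ⟨hS.bijective, hH.isSelfAdjoint hKsa, ⟨ComplexHamilton.spectralProj K, hE, fun Z W =>
    (hH Z W).trans (hloc.hasImproperRSIntegral_iff hE hinj Z W)⟩, fun X₀ => ?_,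
    fun E hEres X hX t => ?_⟩
  · obtain ⟨Y, hY, hY0⟩ := hloc.exists_isIntegralSolution hE hKsa hinj (Λ X₀)
    have hΛS : ∀ t, Λ ⟨S (Y t), hS.mem (Y t)⟩ = Y t := fun t => hS.apply_inverse (Y t)
    refine ⟨fun t => ⟨S (Y t), hS.mem (Y t)⟩, (hmild _).2 ?_, Subtype.ext ?_⟩
    · simpa only [hΛS] using hY
    · change S (Y 0) = X₀
      rw [hY0, hS.inverse_apply]
  -- The resolution `E` is arbitrary, so its localization is derived from its integral
  -- representation and not from the construction of `spectralProj`.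
  · have hloc' := hEres.family.localizes_of_hasImproperRSIntegral
      (hKsa.denseRange_of_injective hinj) fun z w => (hH z w).symm.trans (hEres.integral z w)
    obtain ⟨hm, he⟩ := hS.inverse_eq (X t)
    exact ⟨Λ (X t), hm, ((hmild X).1 hX).hasImproperRSIntegral hloc' hEres.family hKsa hinj t, he⟩
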